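/- Let $\mathcal S\subseteq\mathbb R^d$ and let $\bar\kappa:\mathbb R^d\times\mathbb R^d\to\mathbb R$ be a kernel that is shift-invariant, standardized ($\bar\kappa(s,s)=1$) and bounded ($\bar\kappa(s,s')\le 1$), with spectral probability law $\pi$ on $\mathbb R^d$, i.e. $\bar\kappa(s,s')=\int e^{\mathrm j\zeta^\top(s-s')}\,\pi(d\zeta)$; put $\sigma_\zeta^2=\mathbb E_\pi\|\zeta\|^2\in[0,\infty]$. Let $\gamma\in[0,1)$, $\sigma_\theta,\sigma_n>0$, let $\mathcal H$ be the reproducing kernel Hilbert space on $\mathcal S$ of the kernel $\kappa=\sigma_\theta^2\bar\kappa$, and let $v^*\in\mathcal H$. For $D\ge1$ draw $\zeta_1,\dots,\zeta_D$ i.i.d. from $\pi$ and put $\phi_\zeta(s)=\frac1{\sqrt D}[\sin\zeta_1^\top s,\cos\zeta_1^\top s,\dots,\sin\zeta_D^\top s,\cos\zeta_D^\top s]^\top\in\mathbb R^{2D}$. For a given (deterministic) trajectory of states $s_1,s_2,\ldots\in\mathcal S$ and rewards $r_1,r_2,\ldots\in\mathbb R$, let $h_t=\phi_\zeta(s_t)-\gamma\phi_\zeta(s_{t+1})$.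 The OS-GPTD iterates are $\hat\theta_0=0$, $\Sigma_0=\sigma_\theta^2I_{2D}$ and $$\hat\theta_t=\hat\theta_{t-1}+\frac{\Sigma_{t-1}h_t(r_t-h_t^\top\hat\theta_{t-1})}{h_t^\top\Sigma_{t-1}h_t+\sigma_n^2},\qquad \Sigma_t=\Sigma_{t-1}-\frac{\Sigma_{t-1}h_th_t^\top\Sigma_{t-1}}{h_t^\top\Sigma_{t-1}h_t+\sigma_n^2}.$$ The regret over $T$ slots is $$\mathcal R(T)=\sum_{t=1}^T (r_t-h_t^\top\hat\theta_{t-1})^2-\sum_{t=1}^T (r_t-v^*(s_t)+\gamma v^*(s_{t+1}))^2 .$$ Say that the Bellman error is bounded by $B_e$ up to slot $T$ if for all $1\le t\le T$ one has $|r_t-h_t^\top\hat\theta_{t-1}|\le B_e$ almost surely and $|r_t-v^*(s_t)+\gamma v^*(s_{t+1})|\le B_e$. (1) There is a constant $C>0$, depending only on $d,\mathcal S,\bar\kappa,\gamma,\sigma_\theta,\sigma_n$ and $v^*$ (not on $D$, $T$, $\epsilon$, $B_e$ or the trajectory), such that for every $D\ge1$, every $T$, every trajectory whose Bellman error is bounded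 by $B_e$ up to slot $T$, and every $\epsilon>0$, with probability at least $1-\frac{2^8\sigma_\zeta^2}{\epsilon^2}e^{-D\epsilon^2/(4d+8)}$ over $\zeta_1,\dots,\zeta_D$, $$\mathcal R(T)\le 2(1+\gamma)\epsilon B_eCT+\frac{(1+\epsilon)C^2}{2\sigma_\theta^2}+2DB_e^2\log\Big(\frac{(1+\gamma)^2\sigma_\theta^2}{\sigma_n^2}T+1\Big).$$ (2) Let $\epsilon_T>0$ with $\epsilon_T=O(\log T/T)$ as $T\to\infty$, and let $B_e$ be given. Then there is a constant $K$, independent of $T$, $D$ and the trajectory, such that for all $D\ge1$, all $T\ge2$ and all trajectories whose Bellman error is bounded by $B_e$ up to slot $T$, with probability at least $1-\frac{2^8\sigma_\zeta^2}{\epsilon_T^2}e^{-D\epsilon_T^2/(4d+8)}$ one has $\mathcal R(T)\le K D\log T$; that is, $\mathcal R(T)=O(\log T)$ in $T$, with a constant proportional to $D$. -/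

import Mathlib

open MeasureTheory Filter Asymptotics
open scoped ENNReal Matrix

noncomputable section

/-- The ambient space `ℝ^d` of states, with its Euclidean norm. -/
abbrev State (d : ℕ) : Type := EuclideanSpace ℝ (Fin d)

/-- A kernel that is shift-invariant, standardized and bounded by `1`. -/
structure IsStandardizedShiftInvariant {d : ℕ} (κbar : State d → State d → ℝ) : Prop where
  shift_invariant : ∀ s s' u, κbar (s + u) (s' + u) = κbar s s'
  standardized : ∀ s, κbar s s = 1
  bounded : ∀ s s', κbar s s' ≤ 1

/-- The real kernel `κbar` is the inverse Fourier transform of the spectral probability law `π`: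
`κbar s s' = ∫ exp (j ζᵀ(s - s')) π(dζ)`. -/
def IsSpectralLaw {d : ℕ} (κbar : State d → State d → ℝ) (π : Measure (State d)) : Prop :=
  ∀ s s', (κbar s s' : ℂ) =
    ∫ ζ, Complex.exp (Complex.I * ((inner ℝ ζ (s - s') : ℝ) : ℂ)) ∂π

/-- The second moment `E ‖ζ‖²` of the spectral law (possibly infinite). -/
def secondMoment {d : ℕ} (π : Measure (State d)) : ℝ≥0∞ := ∫⁻ ζ, ‖ζ‖ₑ ^ 2 ∂π

/-- The joint law of `D` i.i.d. frequencies drawn from `π`. -/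
def featureLaw {d : ℕ} (D : ℕ) (π : Measure (State d)) : Measure (Fin D → State d) :=
  Measure.pi fun _ => π

/-- Index set of the `2D` coordinates; `(i, 0)` is the `i`-th sine, `(i, 1)` the `i`-th cosine. -/
abbrev FeatureIndex (D : ℕ) : Type := Fin D × Fin 2

/-- The random feature vector `φ_ζ(s) ∈ ℝ^{2D}`. -/
def randomFeature {d D : ℕ} (ζ : Fin D → State d) (s : State d) : FeatureIndex D → ℝ :=
  fun j => 1 / √(D : ℝ) *
    (if j.2 = 0 then Real.sin (inner ℝ (ζ j.1) s) else Real.cos (inner ℝ (ζ j.1) s))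

/-- `h_t = φ_ζ(s_t) - γ φ_ζ(s_{t+1})`. -/
def tdFeature {d D : ℕ} (γ : ℝ) (ζ : Fin D → State d) (s : ℕ → State d) (t : ℕ) :
    FeatureIndex D → ℝ :=
  randomFeature ζ (s t) - γ • randomFeature ζ (s (t + 1))

/-- One Bayesian update of the posterior mean and covariance `p = (θ, Σ)` with the regression
vector `h` and the reward `r`. -/
def gptdUpdate {ι : Type} [Fintype ι] (σn : ℝ) (h : ι → ℝ) (r : ℝ)
    (p : (ι → ℝ) × Matrix ι ι ℝ) : (ι → ℝ) × Matrix ι ι ℝ :=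
  (p.1 + ((r - h ⬝ᵥ p.1) / (h ⬝ᵥ (p.2 *ᵥ h) + σn ^ 2)) • (p.2 *ᵥ h),
   p.2 - (1 / (h ⬝ᵥ (p.2 *ᵥ h) + σn ^ 2)) • Matrix.vecMulVec (p.2 *ᵥ h) (h ᵥ* p.2))

/-- The posterior moments `(θ̂_t, Σ_t)` of OS-GPTD, with `θ̂_0 = 0` and `Σ_0 = σθ² I`.
Time slots are numbered from `1`; `s 0` and `r 0` are never used. -/
def gptdPosterior {d D : ℕ} (γ σθ σn : ℝ) (ζ : Fin D → State d) (s : ℕ → State d) (r : ℕ → ℝ) :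
    ℕ → (FeatureIndex D → ℝ) × Matrix (FeatureIndex D) (FeatureIndex D) ℝ
  | 0 => (0, σθ ^ 2 • (1 : Matrix (FeatureIndex D) (FeatureIndex D) ℝ))
  | t + 1 =>
      gptdUpdate σn (tdFeature γ ζ s (t + 1)) (r (t + 1)) (gptdPosterior γ σθ σn ζ s r t)

/-- The signed Bellman residual `r_t - h_tᵀ θ̂_{t-1}` of OS-GPTD at slot `t ≥ 1`. -/
def onlineResidual {d D : ℕ} (γ σθ σn : ℝ) (ζ : Fin D → State d) (s : ℕ → State d) (r : ℕ → ℝ)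
    (t : ℕ) : ℝ :=
  r t - tdFeature γ ζ s t ⬝ᵥ (gptdPosterior γ σθ σn ζ s r (t - 1)).1

/-- The signed Bellman residual `r_t - v(s_t) + γ v(s_{t+1})` of a function of the state. -/
def functionResidual {X : Type} (γ : ℝ) (v : X → ℝ) (s : ℕ → X) (r : ℕ → ℝ) (t : ℕ) : ℝ :=
  r t - v (s t) + γ * v (s (t + 1))

/-- The cumulative regret over `T` slots of OS-GPTD against `v`, in terms of the squared Bellman
residuals. -/
def bellmanRegret {d D : ℕ} {S : Set (State d)} (γ σθ σn : ℝ) (v : S → ℝ) (ζ : Fin D → State d)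
    (s : ℕ → S) (r : ℕ → ℝ) (T : ℕ) : ℝ :=
  ∑ t ∈ Finset.Icc 1 T, onlineResidual γ σθ σn ζ (fun t => (s t : State d)) r t ^ 2 -
    ∑ t ∈ Finset.Icc 1 T, functionResidual γ v s r t ^ 2

/-- The Bellman residuals of OS-GPTD (almost surely in the random features) and of the benchmark
`v` are bounded by `Be` up to slot `T`. -/
def BellmanErrorBounded {d : ℕ} {S : Set (State d)} (D : ℕ) (π : Measure (State d))
    (γ σθ σn : ℝ) (v : S → ℝ) (s : ℕ → S) (r : ℕ → ℝ) (T : ℕ) (Be : ℝ) : Prop :=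
  (∀ᵐ ζ ∂(featureLaw D π), ∀ t ∈ Finset.Icc 1 T,
      |onlineResidual γ σθ σn ζ (fun t => (s t : State d)) r t| ≤ Be) ∧
    ∀ t ∈ Finset.Icc 1 T, |functionResidual γ v s r t| ≤ Be

/-- `(2⁸ σ_ζ² / ε²) exp (- D ε² / (4 d + 8))`, as an extended nonnegative real. -/
def failureBound {d : ℕ} (D : ℕ) (π : Measure (State d)) (ε : ℝ) : ℝ≥0∞ :=
  2 ^ 8 * secondMoment π / ENNReal.ofReal (ε ^ 2) *
    ENNReal.ofReal (Real.exp (-((D : ℝ) * ε ^ 2 / (4 * (d : ℝ) + 8))))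

end

noncomputable section

/-! ### Bayesian linear regression against an arbitrary fixed comparator -/

namespace OnlineRegression

variable {ι : Type} [Fintype ι]

/-! OS-GPTD is recursive Bayesian (ridge) regression with regressors `h t`. The potential `(θ - θ̂)ᵀ
P (θ - θ̂)`, with `P` the precision matrix, changes in each slot by a difference of weighted losses
and stays nonnegative. Hence the online errors weighted by `σn² / (x + σn²)`, where `x = hᵀ Σ h`,
total at most the loss of any `θ` plus `σn² ‖θ‖² / σθ²`. The missing weight `x / (x + σn²)` is at
most `log (1 + x / σn²)`; these logarithms telescope to a log-determinant, which the AM–GM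
inequality bounds. This is `sum_sq_errors_le`. It is deterministic and holds for every `θ`, so the
comparator may depend on the trajectory and on the sampled frequencies.

It remains to find a `θ` of bounded norm that reproduces the temporal differences of `v` along the
trajectory. Only finitely many states matter, and on them `v` equals its orthogonal projection onto
the span of their kernel sections. The spectral law turns this projection into a mean of sinusoids
whose amplitudes have second moment at most `(σθ ‖v‖)²` (`exists_spectral_representation`). Uniform
approximation over the state space is not needed: root mean square accuracy of order `ε` over the
visited slots suffices.

One empirical mean over all features would give only a Chebyshev tail. To get an exponential one,
the features are split into `B` independent blocks of `m ≈ 1 / ε²`. Each block has a normalized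
defect `u b` of mean at most 1, so by Markov the product of the `1 + u b` exceeds `4 ^ B` with
probability at most `2⁻ᴮ`. Otherwise, convex weights proportional to `1 / (1 + u b)` suppress the
bad blocks and control error and norm together (`exists_weights`, `exists_coefficients`).

In `exists_regret_bound` the constant `C` is taken large enough to cover the ranges of `ε` where
blocks are unavailable. The logarithmic rate follows by substituting `ε T`. -/

lemma posDef_add_vecMulVec {P : Matrix ι ι ℝ} (hP : P.PosDef) (σn : ℝ) (h : ι → ℝ) :
    (P + (1 / σn ^ 2) • Matrix.vecMulVec h h).PosDef := by
  refine hP.add_posSemidef ?_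
  have := Matrix.posSemidef_vecMulVec_self_star h
  simp only [star_trivial] at this
  exact this.smul (by positivity)

variable [DecidableEq ι]

/-- The precision matrix after `t` observations with regression vectors `h 1, …, h t`. -/
def precision (σθ σn : ℝ) (h : ℕ → ι → ℝ) : ℕ → Matrix ι ι ℝ
  | 0 => (1 / σθ ^ 2) • (1 : Matrix ι ι ℝ)
  | t + 1 => precision σθ σn h t +
      (1 / σn ^ 2) • Matrix.vecMulVec (h (t + 1)) (h (t + 1))

/-- The posterior moments of Bayesian linear regression with regression vectors `h`. -/
def posterior (σθ σn : ℝ) (h : ℕ → ι → ℝ) (r : ℕ → ℝ) : ℕ → (ι → ℝ) × Matrix ι ι ℝ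
  | 0 => (0, σθ ^ 2 • (1 : Matrix ι ι ℝ))
  | t + 1 => gptdUpdate σn (h (t + 1)) (r (t + 1)) (posterior σθ σn h r t)

/-- The recursion does not carry symmetry of the covariance as data; it is recovered from being the
inverse of a positive definite matrix. -/
lemma mulVec_eq_vecMul_of_left_inverse {P S : Matrix ι ι ℝ} (hP : P.PosDef) (hSP : S * P = 1)
    (h : ι → ℝ) : h ᵥ* S = S *ᵥ h := by
  have hS : S = P⁻¹ := (Matrix.inv_eq_left_inv hSP).symm
  have hsymm : Sᵀ = S := by
    have := hP.inv.isHermitian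
    rw [← hS] at this
    simpa [Matrix.IsHermitian, Matrix.conjTranspose_eq_transpose_of_trivial] using this
  rw [← Matrix.mulVec_transpose, hsymm]

lemma dotProduct_mulVec_nonneg_of_left_inverse {P S : Matrix ι ι ℝ} (hP : P.PosDef)
    (hSP : S * P = 1) (h : ι → ℝ) : 0 ≤ h ⬝ᵥ (S *ᵥ h) := by
  have hS : S = P⁻¹ := (Matrix.inv_eq_left_inv hSP).symm
  rw [hS]
  simpa using hP.inv.posSemidef.dotProduct_mulVec_nonneg h

/-- The Sherman–Morrison identity for one update. -/
lemma update_mul_precision {P S : Matrix ι ι ℝ} {σn : ℝ} (hσn : 0 < σn) (hP : P.PosDef)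
    (hSP : S * P = 1) (h : ι → ℝ) (r : ℝ) (θ : ι → ℝ) :
    (gptdUpdate σn h r (θ, S)).2 * (P + (1 / σn ^ 2) • Matrix.vecMulVec h h) = 1 := by
  have hx := dotProduct_mulVec_nonneg_of_left_inverse hP hSP h
  have hq : h ⬝ᵥ (S *ᵥ h) + σn ^ 2 ≠ 0 := by positivity
  simp only [gptdUpdate]
  rw [Matrix.sub_mul, Matrix.mul_add, Matrix.mul_add, hSP, Matrix.smul_mul, Matrix.smul_mul,
    Matrix.vecMulVec_mul, Matrix.vecMul_vecMul, hSP, Matrix.vecMul_one, Matrix.mul_smul,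
    Matrix.mul_smul, Matrix.mul_vecMulVec, Matrix.vecMulVec_mul_vecMulVec,
    ← Matrix.dotProduct_mulVec, Matrix.vecMulVec_smul]
  ext i j
  simp only [Matrix.sub_apply, Matrix.add_apply, Matrix.smul_apply, smul_eq_mul]
  generalize Matrix.vecMulVec (S *ᵥ h) h i j = y
  field_simp
  ring

/-- The potential `(θ - θ̂)ᵀ P (θ - θ̂)` changes in one update by the difference of the losses. -/
lemma update_potential {P S : Matrix ι ι ℝ} {σn : ℝ} (hσn : 0 < σn) (hP : P.PosDef)
    (hSP : S * P = 1) (h : ι → ℝ) (r : ℝ) (μ θ : ι → ℝ) :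
    (θ - (gptdUpdate σn h r (μ, S)).1) ⬝ᵥ
        ((P + (1 / σn ^ 2) • Matrix.vecMulVec h h) *ᵥ (θ - (gptdUpdate σn h r (μ, S)).1)) =
      (θ - μ) ⬝ᵥ (P *ᵥ (θ - μ)) + (r - h ⬝ᵥ θ) ^ 2 / σn ^ 2 -
        (r - h ⬝ᵥ μ) ^ 2 / (h ⬝ᵥ (S *ᵥ h) + σn ^ 2) := by
  have hx := dotProduct_mulVec_nonneg_of_left_inverse hP hSP h
  have hq : h ⬝ᵥ (S *ᵥ h) + σn ^ 2 ≠ 0 := by positivity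
  have hPS : P * S = 1 := mul_eq_one_comm.mp hSP
  simp only [gptdUpdate]
  set c := (r - h ⬝ᵥ μ) / (h ⬝ᵥ (S *ᵥ h) + σn ^ 2) with hc
  have hsub : θ - (μ + c • (S *ᵥ h)) = (θ - μ) - c • (S *ᵥ h) := by abel
  have hθ : r - h ⬝ᵥ θ = (r - h ⬝ᵥ μ) - h ⬝ᵥ (θ - μ) := by rw [dotProduct_sub]; ring
  rw [hsub, hθ]
  generalize θ - μ = δ
  -- The gain direction is `S *ᵥ h`, so `P` sends the correction of the mean back to a multiple of
  -- `h`, and everything reduces to the scalars `h ⬝ᵥ δ` and `h ⬝ᵥ (S *ᵥ h)`.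
  have e1 : P *ᵥ (δ - c • (S *ᵥ h)) = P *ᵥ δ - c • h := by
    rw [Matrix.mulVec_sub, Matrix.mulVec_smul, Matrix.mulVec_mulVec, hPS, Matrix.one_mulVec]
  have e2 : (S *ᵥ h) ⬝ᵥ (P *ᵥ δ) = h ⬝ᵥ δ := by
    rw [← mulVec_eq_vecMul_of_left_inverse hP hSP, ← Matrix.dotProduct_mulVec,
      Matrix.mulVec_mulVec, hSP, Matrix.one_mulVec]
  rw [Matrix.add_mulVec, e1, Matrix.smul_mulVec, Matrix.vecMulVec_mulVec]
  simp only [dotProduct_add, sub_dotProduct, dotProduct_sub, smul_dotProduct, dotProduct_smul,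
    smul_eq_mul, e2, op_smul_eq_smul]
  rw [dotProduct_comm (S *ᵥ h) h, dotProduct_comm δ h, hc]
  field_simp
  ring

/-- The matrix determinant lemma for a rank-one update. It makes the logarithmic sum telescope. -/
lemma det_update {P S : Matrix ι ι ℝ} (σn : ℝ) (hSP : S * P = 1) (h : ι → ℝ) :
    (P + (1 / σn ^ 2) • Matrix.vecMulVec h h).det =
      P.det * (1 + h ⬝ᵥ (S *ᵥ h) / σn ^ 2) := by
  have hS : P⁻¹ = S := Matrix.inv_eq_left_inv hSP
  have hu : IsUnit P.det := by
    have : S.det * P.det = 1 := by rw [← Matrix.det_mul, hSP, Matrix.det_one]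
    exact IsUnit.of_mul_eq_one _ (by rwa [mul_comm] at this)
  rw [← Matrix.smul_vecMulVec, Matrix.vecMulVec_eq Unit,
    Matrix.det_add_replicateCol_mul_replicateRow hu, hS, Matrix.mul_assoc]
  congr 1
  rw [Matrix.det_unique]
  simp only [Matrix.add_apply, Matrix.one_apply_eq]
  congr 1
  have : (Matrix.replicateRow Unit h * (S * Matrix.replicateCol Unit ((1 / σn ^ 2) • h)) :
      Matrix Unit Unit ℝ)
      (default : Unit) (default : Unit) = h ⬝ᵥ (S *ᵥ ((1 / σn ^ 2) • h)) := rfl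
  refine this.trans ?_
  rw [Matrix.mulVec_smul, dotProduct_smul, smul_eq_mul]
  ring

lemma posterior_invariant {σθ σn : ℝ} (hσθ : 0 < σθ) (hσn : 0 < σn) (h : ℕ → ι → ℝ) (r : ℕ → ℝ)
    (t : ℕ) : (precision σθ σn h t).PosDef ∧
      (posterior σθ σn h r t).2 * precision σθ σn h t = 1 := by
  induction t with
  | zero =>
    refine ⟨Matrix.PosDef.one.smul (by positivity), ?_⟩
    simp only [posterior, precision, Matrix.smul_mul, Matrix.mul_smul, Matrix.one_mul, smul_smul]
    rw [one_div_mul_cancel (by positivity), one_smul]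
  | succ t ih =>
    exact ⟨posDef_add_vecMulVec ih.1 σn _, update_mul_precision hσn ih.1 ih.2 _ _ _⟩

/-- Weighted squared prediction errors are dominated by the regularized loss of any comparator. -/
lemma sum_weighted_errors_le {σθ σn : ℝ} (hσθ : 0 < σθ) (hσn : 0 < σn) (h : ℕ → ι → ℝ) (r : ℕ → ℝ)
    (θ : ι → ℝ) (T : ℕ) :
    ∑ t ∈ Finset.range T, (r (t + 1) - h (t + 1) ⬝ᵥ (posterior σθ σn h r t).1) ^ 2 /
        (h (t + 1) ⬝ᵥ ((posterior σθ σn h r t).2 *ᵥ h (t + 1)) + σn ^ 2) ≤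
      ∑ t ∈ Finset.range T, (r (t + 1) - h (t + 1) ⬝ᵥ θ) ^ 2 / σn ^ 2 + θ ⬝ᵥ θ / σθ ^ 2 := by
  have key : (θ - (posterior σθ σn h r T).1) ⬝ᵥ
        (precision σθ σn h T *ᵥ (θ - (posterior σθ σn h r T).1)) =
      θ ⬝ᵥ θ / σθ ^ 2 + ∑ t ∈ Finset.range T, (r (t + 1) - h (t + 1) ⬝ᵥ θ) ^ 2 / σn ^ 2 -
      ∑ t ∈ Finset.range T, (r (t + 1) - h (t + 1) ⬝ᵥ (posterior σθ σn h r t).1) ^ 2 /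
        (h (t + 1) ⬝ᵥ ((posterior σθ σn h r t).2 *ᵥ h (t + 1)) + σn ^ 2) := by
    induction T with
    | zero =>
      simp only [posterior, precision, Matrix.smul_mulVec, Matrix.one_mulVec, sub_zero,
        dotProduct_smul, smul_eq_mul, Finset.range_zero, Finset.sum_empty]
      ring
    | succ T ih =>
      have hinv := posterior_invariant hσθ hσn h r T
      have := update_potential hσn hinv.1 hinv.2 (h (T + 1)) (r (T + 1))
        (posterior σθ σn h r T).1 θ
      rw [Finset.sum_range_succ, Finset.sum_range_succ]
      simp only [posterior, precision]
      refine this.trans ?_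
      rw [ih]
      ring
  -- Discarding the final potential is the only loss in this bound.
  have hpos := (posterior_invariant hσθ hσn h r T).1.posSemidef.dotProduct_mulVec_nonneg
    (θ - (posterior σθ σn h r T).1)
  simp only [star_trivial] at hpos
  linarith

lemma sum_log_eq {σθ σn : ℝ} (hσθ : 0 < σθ) (hσn : 0 < σn) (h : ℕ → ι → ℝ) (r : ℕ → ℝ) (T : ℕ) :
    ∑ t ∈ Finset.range T, Real.log
        (1 + h (t + 1) ⬝ᵥ ((posterior σθ σn h r t).2 *ᵥ h (t + 1)) / σn ^ 2) =
      Real.log (precision σθ σn h T).det - Real.log (precision σθ σn h 0).det := by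
  induction T with
  | zero => simp
  | succ T ih =>
    have hinv := posterior_invariant hσθ hσn h r T
    have hx := dotProduct_mulVec_nonneg_of_left_inverse hinv.1 hinv.2 (h (T + 1))
    rw [Finset.sum_range_succ, ih]
    simp only [precision]
    rw [det_update σn hinv.2, Real.log_mul hinv.1.det_pos.ne' (by positivity)]
    ring

/-- Arithmetic–geometric mean inequality for the determinant, in logarithmic form. -/
lemma log_det_le {P : Matrix ι ι ℝ} (hP : P.PosDef) {c : ℝ} (hc : 0 < c)
    (htr : P.trace ≤ Fintype.card ι * c) : Real.log P.det ≤ Fintype.card ι * Real.log c := by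
  have hev := hP.eigenvalues_pos
  have hdet : P.det = ∏ i, hP.isHermitian.eigenvalues i := by
    simpa using hP.isHermitian.det_eq_prod_eigenvalues
  have htr' : P.trace = ∑ i, hP.isHermitian.eigenvalues i := by
    simpa using hP.isHermitian.trace_eq_sum_eigenvalues
  rw [hdet, Real.log_prod (fun i _ => (hev i).ne')]
  -- AM–GM through the tangent line `log (λ / c) ≤ λ / c - 1`, summed over the eigenvalues.
  calc ∑ i, Real.log (hP.isHermitian.eigenvalues i)
      ≤ ∑ i, (hP.isHermitian.eigenvalues i / c - 1 + Real.log c) := by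
        refine Finset.sum_le_sum fun i _ => ?_
        have := Real.log_le_sub_one_of_pos (div_pos (hev i) hc)
        rw [Real.log_div (hev i).ne' hc.ne'] at this
        linarith
    _ = P.trace / c - Fintype.card ι + Fintype.card ι * Real.log c := by
        rw [htr', Finset.sum_add_distrib, Finset.sum_sub_distrib, Finset.sum_div]
        simp
    _ ≤ _ := by
        have : P.trace / c ≤ Fintype.card ι := (div_le_iff₀ hc).2 htr
        linarith

lemma trace_precision_le {σθ σn b : ℝ} {h : ℕ → ι → ℝ} (hb : ∀ t, h t ⬝ᵥ h t ≤ b) (T : ℕ) :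
    (precision σθ σn h T).trace ≤ Fintype.card ι * (1 / σθ ^ 2) + T * (b / σn ^ 2) := by
  induction T with
  | zero => simp [precision, Matrix.trace_smul, mul_comm]
  | succ T ih =>
    simp only [precision, Matrix.trace_add, Matrix.trace_smul, Matrix.trace_vecMulVec, smul_eq_mul]
    have : 1 / σn ^ 2 * (h (T + 1) ⬝ᵥ h (T + 1)) ≤ b / σn ^ 2 := by
      rw [one_div_mul_eq_div]
      exact div_le_div_of_nonneg_right (hb _) (by positivity)
    push_cast
    linarith

lemma sum_log_le [Nonempty ι] {σθ σn b : ℝ} (hσθ : 0 < σθ) (hσn : 0 < σn) (h : ℕ → ι → ℝ)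
    (r : ℕ → ℝ) (hb : ∀ t, h t ⬝ᵥ h t ≤ b) (T : ℕ) :
    ∑ t ∈ Finset.range T, Real.log
        (1 + h (t + 1) ⬝ᵥ ((posterior σθ σn h r t).2 *ᵥ h (t + 1)) / σn ^ 2) ≤
      Fintype.card ι * Real.log (b * σθ ^ 2 / σn ^ 2 * T + 1) := by
  have hb0 : 0 ≤ b := by
    refine le_trans ?_ (hb 0)
    simpa using dotProduct_star_self_nonneg (h 0)
  have hn : (1 : ℝ) ≤ Fintype.card ι := by exact_mod_cast Fintype.card_pos
  -- The trace over the dimension is at most `1 / σθ² + T b / (n σn²)`, with `n` the dimension;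
  -- dropping `n` only enlarges it and gives an argument of the logarithm independent of the
  -- dimension.
  have hc : (0 : ℝ) < 1 / σθ ^ 2 + T * (b / σn ^ 2) := by positivity
  have h1 := log_det_le (posterior_invariant hσθ hσn h r T).1 hc (by
    refine (trace_precision_le hb T).trans ?_
    have : 0 ≤ T * (b / σn ^ 2) := by positivity
    nlinarith)
  have h0 : Real.log (precision σθ σn h 0).det = Fintype.card ι * Real.log (1 / σθ ^ 2) := by
    simp only [precision, Matrix.det_smul, Matrix.det_one, mul_one, Real.log_pow]
  rw [sum_log_eq hσθ hσn, h0]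
  calc _ ≤ Fintype.card ι * Real.log (1 / σθ ^ 2 + T * (b / σn ^ 2)) -
        Fintype.card ι * Real.log (1 / σθ ^ 2) := by linarith
    _ = _ := by
      rw [← mul_sub, ← Real.log_div hc.ne' (by positivity)]
      congr 2
      field_simp
      ring

/-- Regret of online Bayesian regression with bounded errors against a fixed comparator. -/
theorem sum_sq_errors_le [Nonempty ι] {σθ σn b Be : ℝ} (hσθ : 0 < σθ) (hσn : 0 < σn)
    (h : ℕ → ι → ℝ) (r : ℕ → ℝ) (hb : ∀ t, h t ⬝ᵥ h t ≤ b) (θ : ι → ℝ) (T : ℕ)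
    (hBe : ∀ t < T, |r (t + 1) - h (t + 1) ⬝ᵥ (posterior σθ σn h r t).1| ≤ Be) :
    ∑ t ∈ Finset.range T, (r (t + 1) - h (t + 1) ⬝ᵥ (posterior σθ σn h r t).1) ^ 2 ≤
      ∑ t ∈ Finset.range T, (r (t + 1) - h (t + 1) ⬝ᵥ θ) ^ 2 + σn ^ 2 / σθ ^ 2 * (θ ⬝ᵥ θ) +
        Be ^ 2 * (Fintype.card ι * Real.log (b * σθ ^ 2 / σn ^ 2 * T + 1)) := by
  have h1 := sum_weighted_errors_le hσθ hσn h r θ T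
  have h2 := sum_log_le hσθ hσn h r hb T
  have h3 := mul_le_mul_of_nonneg_left h1 (sq_nonneg σn)
  have h4 : σn ^ 2 * (∑ t ∈ Finset.range T, (r (t + 1) - h (t + 1) ⬝ᵥ θ) ^ 2 / σn ^ 2 +
      θ ⬝ᵥ θ / σθ ^ 2) =
      ∑ t ∈ Finset.range T, (r (t + 1) - h (t + 1) ⬝ᵥ θ) ^ 2 + σn ^ 2 / σθ ^ 2 * (θ ⬝ᵥ θ) := by
    rw [← Finset.sum_div]
    field_simp
  rw [h4, Finset.mul_sum] at h3
  refine le_trans ?_ (add_le_add h3 (mul_le_mul_of_nonneg_left h2 (sq_nonneg Be)))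
  rw [Finset.mul_sum, ← Finset.sum_add_distrib]
  refine Finset.sum_le_sum fun t ht => ?_
  have hinv := posterior_invariant hσθ hσn h r t
  have hx := dotProduct_mulVec_nonneg_of_left_inverse hinv.1 hinv.2 (h (t + 1))
  have he := sq_le_sq' (abs_le.1 (hBe t (Finset.mem_range.1 ht))).1
    (abs_le.1 (hBe t (Finset.mem_range.1 ht))).2
  generalize r (t + 1) - h (t + 1) ⬝ᵥ (posterior σθ σn h r t).1 = e at he ⊢
  generalize h (t + 1) ⬝ᵥ ((posterior σθ σn h r t).2 *ᵥ h (t + 1)) = x at hx ⊢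
  -- This is `1 - 1 / y ≤ log y` at `y = 1 + x / σn²`.
  have hlog : x / (x + σn ^ 2) ≤ Real.log (1 + x / σn ^ 2) := by
    have hy : 0 < 1 + x / σn ^ 2 := by positivity
    have := Real.log_le_sub_one_of_pos (inv_pos.2 hy)
    rw [Real.log_inv] at this
    have e : x / (x + σn ^ 2) = 1 - (1 + x / σn ^ 2)⁻¹ := by
      field_simp
      ring
    linarith
  have hfrac : 0 ≤ x / (x + σn ^ 2) := by positivity
  calc e ^ 2 = σn ^ 2 * (e ^ 2 / (x + σn ^ 2)) + e ^ 2 * (x / (x + σn ^ 2)) := by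
        field_simp
        ring
    _ ≤ _ := by
        gcongr

end OnlineRegression

/-! ### Random features, and regret in terms of linear approximation -/

lemma gptdPosterior_eq_posterior {d D : ℕ} (γ σθ σn : ℝ) (ζ : Fin D → State d) (s : ℕ → State d)
    (r : ℕ → ℝ) (t : ℕ) :
    gptdPosterior γ σθ σn ζ s r t = OnlineRegression.posterior σθ σn (tdFeature γ ζ s) r t := by
  induction t with
  | zero => rfl
  | succ t ih => simp only [gptdPosterior, OnlineRegression.posterior, ih]

lemma randomFeature_dotProduct {d D : ℕ} (ζ : Fin D → State d) (s : State d)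
    (a b : Fin D → ℝ) :
    randomFeature ζ s ⬝ᵥ (fun j => √(D : ℝ) * if j.2 = 0 then a j.1 else b j.1) =
      ∑ i, (a i * Real.sin (inner ℝ (ζ i) s) + b i * Real.cos (inner ℝ (ζ i) s)) := by
  simp only [dotProduct, randomFeature, Fintype.sum_prod_type, Fin.sum_univ_two, if_true,
    Fin.isValue, one_ne_zero, if_false]
  refine Finset.sum_congr rfl fun i _ => ?_
  have hD : 0 < D := i.pos
  have : √(D : ℝ) ≠ 0 := by positivity
  field_simp

lemma randomFeature_dotProduct_self {d D : ℕ} (hD : 0 < D) (ζ : Fin D → State d) (s : State d) :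
    randomFeature ζ s ⬝ᵥ randomFeature ζ s = 1 := by
  simp only [dotProduct, randomFeature, Fintype.sum_prod_type, Fin.sum_univ_two, if_true,
    Fin.isValue, one_ne_zero, if_false]
  have hD' : (0 : ℝ) < D := by exact_mod_cast hD
  have : ∀ i : Fin D, 1 / √(D : ℝ) * Real.sin (inner ℝ (ζ i) s) *
      (1 / √(D : ℝ) * Real.sin (inner ℝ (ζ i) s)) + 1 / √(D : ℝ) * Real.cos (inner ℝ (ζ i) s) *
      (1 / √(D : ℝ) * Real.cos (inner ℝ (ζ i) s)) = 1 / D := fun i => by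
    have h1 := Real.sin_sq_add_cos_sq (inner ℝ (ζ i) s)
    have h2 : (1 / √(D : ℝ)) ^ 2 = 1 / D := by rw [div_pow, Real.sq_sqrt hD'.le, one_pow]
    calc _ = (1 / √(D : ℝ)) ^ 2 *
          (Real.sin (inner ℝ (ζ i) s) ^ 2 + Real.cos (inner ℝ (ζ i) s) ^ 2) := by ring
      _ = _ := by rw [h1, h2, mul_one]
  rw [Finset.sum_congr rfl fun i _ => this i]
  simp [hD'.ne']

/-- Features are unit vectors, so this is the triangle inequality; it supplies the `(1 + γ) ^ 2`
inside the logarithm. -/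
lemma tdFeature_dotProduct_self_le {d D : ℕ} (hD : 0 < D) {γ : ℝ} (hγ : 0 ≤ γ)
    (ζ : Fin D → State d) (s : ℕ → State d) (t : ℕ) :
    tdFeature γ ζ s t ⬝ᵥ tdFeature γ ζ s t ≤ (1 + γ) ^ 2 := by
  have h1 := randomFeature_dotProduct_self hD ζ (s t)
  have h2 := randomFeature_dotProduct_self hD ζ (s (t + 1))
  have h3 : 0 ≤ (randomFeature ζ (s t) + randomFeature ζ (s (t + 1))) ⬝ᵥ
      (randomFeature ζ (s t) + randomFeature ζ (s (t + 1))) := by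
    simpa using dotProduct_star_self_nonneg (randomFeature ζ (s t) + randomFeature ζ (s (t + 1)))
  simp only [tdFeature, add_dotProduct, dotProduct_add, sub_dotProduct, dotProduct_sub,
    smul_dotProduct, dotProduct_smul, smul_eq_mul, h1, h2,
    dotProduct_comm (randomFeature ζ (s (t + 1))) (randomFeature ζ (s t))] at h3 ⊢
  nlinarith

lemma sum_Icc_one_eq_sum_range (f : ℕ → ℝ) (T : ℕ) :
    ∑ t ∈ Finset.Icc 1 T, f t = ∑ t ∈ Finset.range T, f (t + 1) := by
  induction T with
  | zero => simp
  | succ T ih => rw [Finset.sum_Icc_succ_top (by omega), ih, Finset.sum_range_succ]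

lemma sum_onlineResidual_sq_le {d D : ℕ} (hD : 0 < D) {γ σθ σn Be : ℝ} (hγ : 0 ≤ γ) (hσθ : 0 < σθ)
    (hσn : 0 < σn) (ζ : Fin D → State d) (s : ℕ → State d) (r : ℕ → ℝ) (T : ℕ)
    (hBe : ∀ t ∈ Finset.Icc 1 T, |onlineResidual γ σθ σn ζ s r t| ≤ Be)
    (θ : FeatureIndex D → ℝ) :
    ∑ t ∈ Finset.Icc 1 T, onlineResidual γ σθ σn ζ s r t ^ 2 ≤
      ∑ t ∈ Finset.Icc 1 T, (r t - tdFeature γ ζ s t ⬝ᵥ θ) ^ 2 + σn ^ 2 / σθ ^ 2 * (θ ⬝ᵥ θ) +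
        2 * D * Be ^ 2 * Real.log ((1 + γ) ^ 2 * σθ ^ 2 / σn ^ 2 * T + 1) := by
  have : Nonempty (FeatureIndex D) := ⟨(⟨0, hD⟩, 0)⟩
  have h := OnlineRegression.sum_sq_errors_le (Be := Be) hσθ hσn (tdFeature γ ζ s) r
    (tdFeature_dotProduct_self_le hD hγ ζ s) θ T (fun t ht => by
      have := hBe (t + 1) (by simp; omega)
      simpa only [onlineResidual, add_tsub_cancel_right, gptdPosterior_eq_posterior] using this)
  rw [sum_Icc_one_eq_sum_range, sum_Icc_one_eq_sum_range]
  simp only [onlineResidual, add_tsub_cancel_right, gptdPosterior_eq_posterior]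
  refine h.trans (le_of_eq ?_)
  simp only [Fintype.card_prod, Fintype.card_fin, Nat.cast_mul, Nat.cast_ofNat]
  ring

/-- The regret bound in terms of the quality of a linear approximation of `v` along the
trajectory. -/
lemma bellmanRegret_le_of_approx {d D : ℕ} {S : Set (State d)} (hD : 0 < D) {γ σθ σn Be ρ N : ℝ}
    (hγ : 0 ≤ γ) (hσθ : 0 < σθ) (hσn : 0 < σn) (hρ : 0 ≤ ρ) (v : S → ℝ) (ζ : Fin D → State d)
    (s : ℕ → S) (r : ℕ → ℝ) (T : ℕ)
    (hBe : ∀ t ∈ Finset.Icc 1 T, |onlineResidual γ σθ σn ζ (fun t => (s t : State d)) r t| ≤ Be)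
    (hBe' : ∀ t ∈ Finset.Icc 1 T, |functionResidual γ v s r t| ≤ Be)
    (θ : FeatureIndex D → ℝ) (hθ : θ ⬝ᵥ θ ≤ N)
    (happ : ∑ t ∈ Finset.Icc 1 T, (tdFeature γ ζ (fun t => (s t : State d)) t ⬝ᵥ θ -
      (v (s t) - γ * v (s (t + 1)))) ^ 2 ≤ T * ρ ^ 2) :
    bellmanRegret γ σθ σn v ζ s r T ≤ 3 * Be * ρ * T + σn ^ 2 / σθ ^ 2 * N +
        2 * D * Be ^ 2 * Real.log ((1 + γ) ^ 2 * σθ ^ 2 / σn ^ 2 * T + 1) := by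
  have hN : 0 ≤ N := le_trans (by simpa using dotProduct_star_self_nonneg θ) hθ
  have hlog : 0 ≤ 2 * D * Be ^ 2 * Real.log ((1 + γ) ^ 2 * σθ ^ 2 / σn ^ 2 * T + 1) := by
    refine mul_nonneg (by positivity) (Real.log_nonneg ?_)
    have : 0 ≤ (1 + γ) ^ 2 * σθ ^ 2 / σn ^ 2 * T := by positivity
    linarith
  have hpen : 0 ≤ σn ^ 2 / σθ ^ 2 * N := by positivity
  rcases Nat.eq_zero_or_pos T with rfl | hT
  · simp only [bellmanRegret]
    simpa using hpen
  have hBe0 : 0 ≤ Be := (abs_nonneg _).trans (hBe' 1 (by simp; omega))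
  have hcard : (Finset.Icc 1 T).card = T := by simp
  -- If `ρ` exceeds `Be`, the trivial bound `T Be²` suffices. Otherwise the quadratic error `T ρ²`
  -- is at most `Be ρ T` and joins the cross term `2 Be ρ T`, whence the factor 3.
  rcases le_total Be ρ with hBρ | hBρ
  · have h1 : bellmanRegret γ σθ σn v ζ s r T ≤ T * Be ^ 2 := by
      have ha : ∑ t ∈ Finset.Icc 1 T,
          onlineResidual γ σθ σn ζ (fun t => (s t : State d)) r t ^ 2 ≤ T * Be ^ 2 := by
        calc _ ≤ ∑ t ∈ Finset.Icc 1 T, Be ^ 2 :=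
              Finset.sum_le_sum fun t ht => sq_le_sq.2 ((hBe t ht).trans (le_abs_self _))
          _ = _ := by simp
      have hb : 0 ≤ ∑ t ∈ Finset.Icc 1 T, functionResidual γ v s r t ^ 2 :=
        Finset.sum_nonneg fun _ _ => sq_nonneg _
      simp only [bellmanRegret]
      linarith
    have h2 : (T : ℝ) * Be ^ 2 ≤ 3 * Be * ρ * T := by
      have : Be * Be ≤ Be * ρ := mul_le_mul_of_nonneg_left hBρ hBe0
      have h3 : (0 : ℝ) ≤ T := by positivity
      have h4 : 0 ≤ Be * ρ := by positivity
      nlinarith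
    linarith
  · have h1 := sum_onlineResidual_sq_le hD hγ hσθ hσn ζ (fun t => (s t : State d)) r T hBe θ
    have h2 : σn ^ 2 / σθ ^ 2 * (θ ⬝ᵥ θ) ≤ σn ^ 2 / σθ ^ 2 * N :=
      mul_le_mul_of_nonneg_left hθ (by positivity)
    set Δ : ℕ → ℝ := fun t => tdFeature γ ζ (fun t => (s t : State d)) t ⬝ᵥ θ -
      (v (s t) - γ * v (s (t + 1))) with hΔ
    have happ' : ∑ t ∈ Finset.Icc 1 T, Δ t ^ 2 ≤ T * ρ ^ 2 := happ
    have habs : ∑ t ∈ Finset.Icc 1 T, |Δ t| ≤ T * ρ := by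
      refine abs_le_of_sq_le_sq' ?_ (by positivity) |>.2
      calc (∑ t ∈ Finset.Icc 1 T, |Δ t|) ^ 2 ≤ T * ∑ t ∈ Finset.Icc 1 T, |Δ t| ^ 2 := by
            have := sq_sum_le_card_mul_sum_sq (s := Finset.Icc 1 T) (f := fun t => |Δ t|)
            rwa [hcard] at this
        _ ≤ T * (T * ρ ^ 2) := by
            simp only [sq_abs]
            exact mul_le_mul_of_nonneg_left happ' (by positivity)
        _ = _ := by ring
    have hstep : ∑ t ∈ Finset.Icc 1 T,
          (r t - tdFeature γ ζ (fun t => (s t : State d)) t ⬝ᵥ θ) ^ 2 ≤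
        ∑ t ∈ Finset.Icc 1 T, (functionResidual γ v s r t ^ 2 + 2 * Be * |Δ t| + Δ t ^ 2) := by
      refine Finset.sum_le_sum fun t ht => ?_
      have e : r t - tdFeature γ ζ (fun t => (s t : State d)) t ⬝ᵥ θ =
          functionResidual γ v s r t - Δ t := by
        simp only [functionResidual, hΔ]
        ring
      rw [e]
      have h3 : -(functionResidual γ v s r t * Δ t) ≤ Be * |Δ t| := by
        refine (neg_le_abs _).trans ?_
        rw [abs_mul]
        exact mul_le_mul_of_nonneg_right (hBe' t ht) (abs_nonneg _)
      nlinarith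
    rw [Finset.sum_add_distrib, Finset.sum_add_distrib, ← Finset.mul_sum] at hstep
    have h3 : 2 * Be * ∑ t ∈ Finset.Icc 1 T, |Δ t| ≤ 2 * Be * (T * ρ) :=
      mul_le_mul_of_nonneg_left habs (by positivity)
    have h4 : (T : ℝ) * ρ ^ 2 ≤ T * (Be * ρ) := by
      rw [sq]
      exact mul_le_mul_of_nonneg_left (mul_le_mul_of_nonneg_right hBρ hρ) (by positivity)
    simp only [bellmanRegret]
    nlinarith

/-! ### Spectral representation of RKHS elements on finite sets -/

lemma integrable_cos_inner {d : ℕ} (π : Measure (State d)) [IsProbabilityMeasure π]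
    (u : State d) : Integrable (fun ζ : State d => Real.cos (inner ℝ ζ u)) π := by
  refine Integrable.of_bound (by fun_prop) 1 (Eventually.of_forall fun ζ => ?_)
  simpa using Real.abs_cos_le_one _

lemma IsSpectralLaw.eq_integral_cos {d : ℕ} {κbar : State d → State d → ℝ}
    {π : Measure (State d)} [IsProbabilityMeasure π] (hπ : IsSpectralLaw κbar π)
    (x y : State d) : κbar x y = ∫ ζ, Real.cos (inner ℝ ζ (x - y)) ∂π := by
  have h := congrArg Complex.re (hπ x y)
  rw [Complex.ofReal_re] at h
  have hint : Integrable
      (fun ζ : State d => Complex.exp (Complex.I * ((inner ℝ ζ (x - y) : ℝ) : ℂ))) π := by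
    refine Integrable.of_bound (by fun_prop) 1 (Eventually.of_forall fun ζ => ?_)
    rw [mul_comm, Complex.norm_exp_ofReal_mul_I]
  rw [h]
  have := (Complex.reCLM.integral_comp_comm hint).symm
  simp only [Complex.reCLM_apply] at this
  rw [this]
  refine integral_congr_ae (Eventually.of_forall fun ζ => ?_)
  simp only
  rw [mul_comm, Complex.exp_ofReal_mul_I_re]

/-- On a finite set, an element `v` of the reproducing kernel Hilbert space agrees with a
combination of kernel functions whose quadratic form is controlled by `‖v‖`. -/
lemma exists_kernel_interpolation {d : ℕ} {S : Set (State d)}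
    {H : Type*} [NormedAddCommGroup H] [InnerProductSpace ℝ H] [CompleteSpace H] [RKHS ℝ H S ℝ]
    {κbar : State d → State d → ℝ} {σθ : ℝ} (hσθ : 0 < σθ)
    (hH : ∀ x y : S, RKHS.kernel H x y 1 = σθ ^ 2 * κbar x y) (v : H) (A : Finset S) :
    ∃ b : S → ℝ, (∀ x ∈ A, v x = ∑ y ∈ A, b y * κbar x y) ∧
      ∑ x ∈ A, ∑ y ∈ A, b x * b y * κbar x y ≤ (σθ * ‖v‖) ^ 2 := by
  classical
  set k : S → H := fun x => RKHS.kerFun H x 1 with hk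
  set U : Submodule ℝ H := Submodule.span ℝ (k '' (A : Set S)) with hU
  have hfin : FiniteDimensional ℝ U :=
    FiniteDimensional.span_of_finite ℝ (A.finite_toSet.image k)
  -- Projecting keeps the values on `A`, by the reproducing property, does not increase the norm,
  -- and leaves a finite kernel combination.
  set w : H := U.starProjection v with hw
  have hwU : w ∈ U := Submodule.starProjection_apply_mem U v
  obtain ⟨a, ha⟩ := (Submodule.mem_span_image_finset_iff_exists_fun' ℝ).1 hwU
  have hkk : ∀ x y : S, inner ℝ (k x) (k y) = σθ ^ 2 * κbar x y := fun x y => by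
    rw [hk, RKHS.kerFun_inner, RKHS.kerFun_apply, hH]
    simp
  have hvw : ∀ x ∈ A, v x = inner ℝ (k x) w := fun x hx => by
    have h1 : inner ℝ (k x) v = v x := by simp [hk]
    have h2 : inner ℝ (k x) (v - w) = 0 :=
      Submodule.inner_right_of_mem_orthogonal
        (Submodule.subset_span (Set.mem_image_of_mem k (Finset.mem_coe.2 hx)))
        (Submodule.sub_starProjection_mem_orthogonal v)
    rw [inner_sub_right, h1] at h2
    linarith
  have hnorm : ‖w‖ ≤ ‖v‖ := Submodule.norm_starProjection_apply_le U v
  refine ⟨fun y => σθ ^ 2 * a y, fun x hx => ?_, ?_⟩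
  · rw [hvw x hx, ← ha, inner_sum]
    refine Finset.sum_congr rfl fun y _ => ?_
    rw [inner_smul_right, hkk]
    ring
  · have h1 : ‖w‖ ^ 2 = ∑ x ∈ A, ∑ y ∈ A, a x * a y * (σθ ^ 2 * κbar x y) := by
      rw [← real_inner_self_eq_norm_sq, ← ha, sum_inner]
      refine Finset.sum_congr rfl fun x _ => ?_
      rw [inner_sum]
      refine Finset.sum_congr rfl fun y _ => ?_
      rw [real_inner_smul_left, real_inner_smul_right, hkk]
      ring
    calc _ = σθ ^ 2 * ‖w‖ ^ 2 := by
          rw [h1, Finset.mul_sum]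
          refine Finset.sum_congr rfl fun x _ => ?_
          rw [Finset.mul_sum]
          refine Finset.sum_congr rfl fun y _ => ?_
          ring
      _ ≤ σθ ^ 2 * ‖v‖ ^ 2 := by gcongr
      _ = _ := by ring

/-- On a finite set, an element of the reproducing kernel Hilbert space is a mean of random
sinusoids with square-integrable amplitudes. -/
lemma exists_spectral_representation {d : ℕ} {S : Set (State d)}
    {H : Type*} [NormedAddCommGroup H] [InnerProductSpace ℝ H] [CompleteSpace H] [RKHS ℝ H S ℝ]
    {κbar : State d → State d → ℝ} {π : Measure (State d)} [IsProbabilityMeasure π] {σθ : ℝ}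
    (hσθ : 0 < σθ) (hπ : IsSpectralLaw κbar π)
    (hH : ∀ x y : S, RKHS.kernel H x y 1 = σθ ^ 2 * κbar x y) (v : H) (A : Finset S) :
    ∃ p q : State d → ℝ, Continuous p ∧ Continuous q ∧ (∃ M, ∀ ζ, |p ζ| ≤ M ∧ |q ζ| ≤ M) ∧
      (∫ ζ, (p ζ ^ 2 + q ζ ^ 2) ∂π ≤ (σθ * ‖v‖) ^ 2) ∧
      ∀ x ∈ A, v x =
        ∫ ζ, (p ζ * Real.sin (inner ℝ ζ (x : State d)) +
          q ζ * Real.cos (inner ℝ ζ (x : State d))) ∂π := by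
  obtain ⟨b, hb, hb2⟩ := exists_kernel_interpolation hσθ hH v A
  -- The amplitudes are the imaginary and real parts of `∑ b y exp (j ζᵀ y)`. The sup bound depends
  -- on `A` and serves integrability only; the quantitative control is the second moment.
  refine ⟨fun ζ => ∑ y ∈ A, b y * Real.sin (inner ℝ ζ (y : State d)),
    fun ζ => ∑ y ∈ A, b y * Real.cos (inner ℝ ζ (y : State d)), by fun_prop, by fun_prop,
    ⟨∑ y ∈ A, |b y|, fun ζ => ⟨?_, ?_⟩⟩, ?_, fun x hx => ?_⟩
  · refine (Finset.abs_sum_le_sum_abs _ _).trans (Finset.sum_le_sum fun y _ => ?_)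
    rw [abs_mul]
    exact mul_le_of_le_one_right (abs_nonneg _) (Real.abs_sin_le_one _)
  · refine (Finset.abs_sum_le_sum_abs _ _).trans (Finset.sum_le_sum fun y _ => ?_)
    rw [abs_mul]
    exact mul_le_of_le_one_right (abs_nonneg _) (Real.abs_cos_le_one _)
  · refine le_trans (le_of_eq ?_) hb2
    have e : ∀ ζ : State d, (∑ y ∈ A, b y * Real.sin (inner ℝ ζ (y : State d))) ^ 2 +
        (∑ y ∈ A, b y * Real.cos (inner ℝ ζ (y : State d))) ^ 2 =
        ∑ x ∈ A, ∑ y ∈ A, b x * b y * Real.cos (inner ℝ ζ ((x : State d) - y)) := fun ζ => by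
      rw [sq, sq, Finset.sum_mul_sum, Finset.sum_mul_sum, ← Finset.sum_add_distrib]
      refine Finset.sum_congr rfl fun x _ => ?_
      rw [← Finset.sum_add_distrib]
      refine Finset.sum_congr rfl fun y _ => ?_
      rw [inner_sub_right, Real.cos_sub]
      ring
    simp only [e]
    rw [integral_finsetSum _ fun x _ => integrable_finsetSum _ fun y _ =>
      (integrable_cos_inner π _).const_mul _]
    refine Finset.sum_congr rfl fun x _ => ?_
    rw [integral_finsetSum _ fun y _ => (integrable_cos_inner π _).const_mul _]
    refine Finset.sum_congr rfl fun y _ => ?_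
    rw [integral_const_mul, hπ.eq_integral_cos]
  · rw [hb x hx]
    have e : ∀ ζ : State d, (∑ y ∈ A, b y * Real.sin (inner ℝ ζ (y : State d))) *
        Real.sin (inner ℝ ζ (x : State d)) +
        (∑ y ∈ A, b y * Real.cos (inner ℝ ζ (y : State d))) * Real.cos (inner ℝ ζ (x : State d)) =
        ∑ y ∈ A, b y * Real.cos (inner ℝ ζ ((x : State d) - y)) := fun ζ => by
      rw [Finset.sum_mul, Finset.sum_mul, ← Finset.sum_add_distrib]
      refine Finset.sum_congr rfl fun y _ => ?_
      rw [inner_sub_right, Real.cos_sub]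
      ring
    simp only [e]
    rw [integral_finsetSum _ fun y _ => (integrable_cos_inner π _).const_mul _]
    refine Finset.sum_congr rfl fun y _ => ?_
    rw [integral_const_mul, hπ.eq_integral_cos]

/-! ### Exponential concentration from weighted blocks of samples -/

namespace BlockSampling

variable {E : Type*} [MeasurableSpace E] (π : Measure E)

/-- The scaled squared error of the empirical means of `F t`, `t ∈ A`, plus the empirical mean
of `N`, over a block `z` of `m` samples. -/
def blockDefect (A : Finset ℕ) (F : ℕ → E → ℝ) (N : E → ℝ) {m : ℕ} (z : Fin m → E) : ℝ :=
  m / A.card * ∑ t ∈ A, (1 / m * ∑ k, F t (z k) - ∫ x, F t x ∂π) ^ 2 + 1 / m * ∑ k, N (z k)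

lemma blockDefect_nonneg (A : Finset ℕ) (F : ℕ → E → ℝ) {N : E → ℝ} (hN : ∀ x, 0 ≤ N x) {m : ℕ}
    (z : Fin m → E) : 0 ≤ blockDefect π A F N z := by
  have := Finset.sum_nonneg fun (k : Fin m) (_ : k ∈ Finset.univ) => hN (z k)
  unfold blockDefect
  positivity

lemma measurable_blockDefect (A : Finset ℕ) {F : ℕ → E → ℝ} {N : E → ℝ}
    (hF : ∀ t, Measurable (F t)) (hN : Measurable N) {m : ℕ} :
    Measurable fun z : Fin m → E => blockDefect π A F N z := by
  unfold blockDefect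
  have := fun t (k : Fin m) => (hF t).comp (measurable_pi_apply (X := fun _ : Fin m => E) k)
  have := fun (k : Fin m) => hN.comp (measurable_pi_apply (X := fun _ : Fin m => E) k)
  fun_prop

/-- If the geometric mean of `1 + u b` is at most `4`, some convex weights make all the weighted
values small. -/
lemma exists_weights {B : ℕ} (hB : 0 < B) {u : Fin B → ℝ} (hu : ∀ b, 0 ≤ u b)
    (hprod : ∏ b, (1 + u b) ≤ 4 ^ B) :
    ∃ a : Fin B → ℝ, (∀ b, 0 ≤ a b) ∧ ∑ b, a b = 1 ∧ ∀ b, a b * u b ≤ 4 / B := by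
  have hB' : (0 : ℝ) < B := by exact_mod_cast hB
  have hpos : ∀ b, 0 < 1 + u b := fun b => by linarith [hu b]
  set W : ℝ := ∑ b, (1 + u b)⁻¹ with hW
  have hWB : (B : ℝ) / 4 ≤ W := by
    have hlog : ∑ b, Real.log (1 + u b) ≤ B * Real.log 4 := by
      rw [← Real.log_prod fun b _ => (hpos b).ne', ← Real.log_pow]
      exact Real.log_le_log (Finset.prod_pos fun b _ => hpos b) hprod
    -- The tangent line of `exp` at 0, with argument `log 4 - log (1 + u b)`; summed, it shows that
    -- the mean of `1 / (1 + u b)` is at least `1 / 4`.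
    have hterm : ∀ b, (1 / 4 : ℝ) * (1 - (Real.log (1 + u b) - Real.log 4)) ≤ (1 + u b)⁻¹ :=
      fun b => by
        have h := Real.add_one_le_exp (Real.log 4 - Real.log (1 + u b))
        rw [Real.exp_sub, Real.exp_log (by norm_num), Real.exp_log (hpos b)] at h
        rw [div_eq_mul_inv] at h
        linarith
    have hsum := Finset.sum_le_sum fun b (_ : b ∈ Finset.univ) => hterm b
    rw [← Finset.mul_sum, Finset.sum_sub_distrib, Finset.sum_sub_distrib] at hsum
    simp only [Finset.sum_const, Finset.card_univ, Fintype.card_fin, nsmul_eq_mul, mul_one] at hsum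
    rw [hW]
    linarith
  have hWpos : 0 < W := by linarith [div_pos hB' (by norm_num : (0 : ℝ) < 4)]
  refine ⟨fun b => (1 + u b)⁻¹ / W, fun b => by have := hpos b; positivity, ?_, fun b => ?_⟩
  · rw [← Finset.sum_div, div_self hWpos.ne']
  · have h1 : (1 + u b)⁻¹ * u b ≤ 1 := by
      rw [inv_mul_le_iff₀ (hpos b)]
      linarith
    calc (1 + u b)⁻¹ / W * u b = (1 + u b)⁻¹ * u b / W := by ring
      _ ≤ 1 / W := by gcongr
      _ ≤ 1 / (B / 4) := by gcongr
      _ = 4 / B := by field_simp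

/-- Jensen's inequality for the square. -/
lemma sq_sum_mul_le {κ : Type*} [Fintype κ] {a : κ → ℝ} (ha : ∀ b, 0 ≤ a b) (hsum : ∑ b, a b = 1)
    (y : κ → ℝ) : (∑ b, a b * y b) ^ 2 ≤ ∑ b, a b * y b ^ 2 := by
  have := (even_two.convexOn_pow (𝕜 := ℝ)).map_sum_le (t := Finset.univ) (w := a) (p := y)
    (fun b _ => ha b) hsum (fun _ _ => Set.mem_univ _)
  simpa only [smul_eq_mul] using this

/-- If the block defects have small geometric mean, a weighted combination of all samples
approximates all the means simultaneously. -/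
lemma exists_coefficients {ι : Type*} [Fintype ι] {A : Finset ℕ} (hA : A.Nonempty)
    {F : ℕ → E → ℝ} {N : E → ℝ} (hN0 : ∀ x, 0 ≤ N x) {x : ℝ} (hx : 0 < x) {B m : ℕ} (hB : 0 < B)
    (hm : 0 < m) {e : Fin B × Fin m → ι} (he : Function.Injective e) (ζ : ι → E)
    (hprod : ∏ b, (1 + blockDefect π A F N (fun k => ζ (e (b, k))) / (2 * x)) ≤ 4 ^ B) :
    ∃ c : ι → ℝ, ∑ t ∈ A, (∑ i, c i * F t (ζ i) - ∫ y, F t y ∂π) ^ 2 ≤ A.card * (8 * x / m) ∧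
      ∑ i, c i ^ 2 * N (ζ i) ≤ 8 * x / (B * m) := by
  have hB' : (0 : ℝ) < B := by exact_mod_cast hB
  have hm' : (0 : ℝ) < m := by exact_mod_cast hm
  have hA' : (0 : ℝ) < A.card := by exact_mod_cast hA.card_pos
  set X : Fin B → ℝ := fun b => blockDefect π A F N (fun k => ζ (e (b, k))) with hX
  have hX0 : ∀ b, 0 ≤ X b := fun b => blockDefect_nonneg π A F hN0 _
  obtain ⟨a, ha0, ha1, hau⟩ := exists_weights hB (u := fun b => X b / (2 * x))
    (fun b => div_nonneg (hX0 b) (by positivity)) hprod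
  have haX : ∀ b, a b * X b ≤ 8 * x / B := fun b => by
    have := mul_le_mul_of_nonneg_right (hau b) (by positivity : 0 ≤ 2 * x)
    calc a b * X b = a b * (X b / (2 * x)) * (2 * x) := by field_simp
      _ ≤ 4 / B * (2 * x) := this
      _ = _ := by ring
  have hXF : ∀ b, ∑ t ∈ A, (1 / m * ∑ k, F t (ζ (e (b, k))) - ∫ y, F t y ∂π) ^ 2 ≤
      A.card / m * X b := fun b => by
    have h1 : 0 ≤ 1 / (m : ℝ) * ∑ k, N (ζ (e (b, k))) := by
      have := Finset.sum_nonneg fun (k : Fin m) (_ : k ∈ Finset.univ) => hN0 (ζ (e (b, k)))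
      positivity
    rw [div_mul_eq_mul_div, le_div_iff₀ hm', ← div_le_iff₀' hA']
    calc _ = (m : ℝ) / A.card *
          ∑ t ∈ A, (1 / m * ∑ k, F t (ζ (e (b, k))) - ∫ y, F t y ∂π) ^ 2 := by ring
      _ ≤ X b := by
        simp only [hX, blockDefect]
        linarith
  have hXN : ∀ b, ∑ k, N (ζ (e (b, k))) ≤ m * X b := fun b => by
    have h1 : 0 ≤ (m : ℝ) / A.card *
        ∑ t ∈ A, (1 / m * ∑ k, F t (ζ (e (b, k))) - ∫ y, F t y ∂π) ^ 2 := by positivity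
    rw [← div_le_iff₀' hm']
    calc _ = 1 / (m : ℝ) * ∑ k, N (ζ (e (b, k))) := by ring
      _ ≤ X b := by
        simp only [hX, blockDefect]
        linarith
  -- Each sample of block `b` gets weight `a b / m`; samples left over by the division into blocks
  -- get weight zero.
  set c : ι → ℝ := Function.extend e (fun p => a p.1 / m) 0 with hc
  have hce : ∀ p, c (e p) = a p.1 / m := fun p => he.extend_apply _ _ _
  have hc0 : ∀ i ∉ Set.range e, c i = 0 := fun i hi => by
    rw [hc, Function.extend_apply' _ _ _ (by simpa using hi)]
    rfl
  refine ⟨c, ?_, ?_⟩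
  · have hsum : ∀ t, ∑ i, c i * F t (ζ i) =
        ∑ b, a b * (1 / m * ∑ k, F t (ζ (e (b, k)))) := fun t => by
      rw [← Fintype.sum_of_injective e he (fun p => a p.1 / m * F t (ζ (e p))) _
        (fun i hi => by rw [hc0 i hi, zero_mul]) (fun p => by rw [hce]), Fintype.sum_prod_type]
      refine Finset.sum_congr rfl fun b _ => ?_
      rw [Finset.mul_sum, Finset.mul_sum]
      refine Finset.sum_congr rfl fun k _ => ?_
      ring
    have hdiff : ∀ t, ∑ i, c i * F t (ζ i) - ∫ y, F t y ∂π =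
        ∑ b, a b * (1 / m * ∑ k, F t (ζ (e (b, k))) - ∫ y, F t y ∂π) := fun t => by
      simp only [mul_sub, Finset.sum_sub_distrib, ← Finset.sum_mul, ha1, one_mul, hsum]
    calc _ ≤ ∑ t ∈ A, ∑ b, a b * (1 / m * ∑ k, F t (ζ (e (b, k))) - ∫ y, F t y ∂π) ^ 2 := by
          refine Finset.sum_le_sum fun t _ => ?_
          rw [hdiff]
          exact sq_sum_mul_le ha0 ha1 _
      _ = ∑ b, a b * ∑ t ∈ A, (1 / m * ∑ k, F t (ζ (e (b, k))) - ∫ y, F t y ∂π) ^ 2 := by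
          rw [Finset.sum_comm]
          simp only [Finset.mul_sum]
      _ ≤ ∑ b : Fin B, A.card / m * (8 * x / B) := by
          refine Finset.sum_le_sum fun b _ => ?_
          refine (mul_le_mul_of_nonneg_left (hXF b) (ha0 b)).trans ?_
          rw [mul_left_comm]
          exact mul_le_mul_of_nonneg_left (haX b) (by positivity)
      _ = _ := by
          simp only [Finset.sum_const, Finset.card_univ, Fintype.card_fin, nsmul_eq_mul]
          field_simp
  · rw [← Fintype.sum_of_injective e he (fun p => (a p.1 / m) ^ 2 * N (ζ (e p))) _
        (fun i hi => by rw [hc0 i hi]; simp) (fun p => by rw [hce]), Fintype.sum_prod_type]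
    calc _ = ∑ b, (a b / m) ^ 2 * ∑ k, N (ζ (e (b, k))) := by simp only [Finset.mul_sum]
      _ ≤ ∑ b, a b * (8 * x / (B * m)) := by
          refine Finset.sum_le_sum fun b _ => ?_
          refine (mul_le_mul_of_nonneg_left (hXN b) (sq_nonneg _)).trans ?_
          -- One factor `a b` tames the defect `X b`; the other is kept so that the weights sum to
          -- 1, which yields the extra `1 / B`.
          calc (a b / m) ^ 2 * (m * X b) = a b * (a b * X b / m) := by field_simp
            _ ≤ a b * (8 * x / B / m) := by
                have := haX b
                have := ha0 b
                gcongr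
            _ = _ := by rw [div_div]
      _ = _ := by rw [← Finset.sum_mul, ha1, one_mul]

variable [IsProbabilityMeasure π]

/-- Distinct coordinates of a product measure are i.i.d., and currying makes the blocks i.i.d. as
well. -/
lemma measurePreserving_blocks {ι : Type*} [Fintype ι] {B m : ℕ} {e : Fin B × Fin m → ι}
    (he : Function.Injective e) :
    MeasurePreserving (fun (ζ : ι → E) (b : Fin B) (k : Fin m) => ζ (e (b, k)))
      (Measure.pi fun _ => π) (Measure.pi fun _ => Measure.pi fun _ => π) := by
  refine ⟨by fun_prop, ?_⟩
  have hind : ProbabilityTheory.iIndepFun (fun (i : ι) (ζ : ι → E) => ζ i)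
      (Measure.pi fun _ => π) :=
    ProbabilityTheory.iIndepFun_pi (X := fun _ x => x) fun _ => aemeasurable_id
  have h1 := (hind.precomp he).map_fun_eq_pi_map (fun p => (measurable_pi_apply (e p)).aemeasurable)
  have h2 : (fun p : Fin B × Fin m =>
      (Measure.pi fun _ : ι => π).map (fun ζ : ι → E => ζ (e p))) = fun _ => π := by
    funext p
    exact (measurePreserving_eval (fun _ : ι => π) (e p)).map_eq
  have h3 : (Measure.pi fun _ : ι => π).map (fun ζ p => ζ (e p)) =
      Measure.pi fun _ : Fin B × Fin m => π := by
    rw [← h2]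
    exact h1
  have h4 := Measure.infinitePi_map_curry (fun (_ : Fin B) (_ : Fin m) => π)
  simp only [Measure.infinitePi_eq_pi] at h4
  rw [← h4, ← h3, Measure.map_map (by fun_prop) (by fun_prop)]
  rfl

lemma integral_comp_eval {m : ℕ} {G : E → ℝ} (hG : Measurable G) (k : Fin m) :
    ∫ z : Fin m → E, G (z k) ∂(Measure.pi fun _ => π) = ∫ x, G x ∂π := by
  have h := (measurePreserving_eval (fun _ : Fin m => π) k).map_eq
  conv_rhs => rw [← h]
  rw [integral_map (measurable_pi_apply k).aemeasurable hG.aestronglyMeasurable]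

lemma integrable_comp_eval {m : ℕ} {G : E → ℝ} (hG : Integrable G π) (k : Fin m) :
    Integrable (fun z : Fin m → E => G (z k)) (Measure.pi fun _ => π) :=
  (measurePreserving_eval (fun _ : Fin m => π) k).integrable_comp_of_integrable hG

lemma integral_sq_mean_sub_le {m : ℕ} (hm : 0 < m) {F : E → ℝ} (hF : Measurable F) {M : ℝ}
    (hM : ∀ x, |F x| ≤ M) :
    ∫ z : Fin m → E, (1 / m * ∑ k, F (z k) - ∫ x, F x ∂π) ^ 2 ∂(Measure.pi fun _ => π) ≤
      (∫ x, F x ^ 2 ∂π) / m := by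
  have hm' : (0 : ℝ) < m := by exact_mod_cast hm
  have hmem : MemLp F 2 π := MemLp.of_bound hF.aestronglyMeasurable M (Eventually.of_forall hM)
  have hint : Integrable F π := hmem.integrable (by norm_num)
  set Y : (Fin m → E) → ℝ := ∑ k, fun z : Fin m → E => F (z k) with hY
  have hYapp : ∀ z, Y z = ∑ k, F (z k) := fun z => by simp [hY]
  have hYm : Measurable Y := by
    have : Y = fun z => ∑ k, F (z k) := funext hYapp
    rw [this]
    fun_prop
  have hmean : ∫ z, Y z ∂(Measure.pi fun _ : Fin m => π) = m * ∫ x, F x ∂π := by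
    simp only [hYapp]
    rw [integral_finsetSum _ fun k _ => integrable_comp_eval π hint k]
    simp [integral_comp_eval π hF]
  have hvar : ProbabilityTheory.variance Y (Measure.pi fun _ : Fin m => π) =
      m * ProbabilityTheory.variance F π := by
    rw [hY, ProbabilityTheory.variance_sum_pi (X := fun _ => F) fun _ => hmem]
    simp
  have hle : ProbabilityTheory.variance F π ≤ ∫ x, F x ^ 2 ∂π :=
    ProbabilityTheory.variance_le_expectation_sq hF.aestronglyMeasurable
  rw [ProbabilityTheory.variance_eq_integral hYm.aemeasurable, hmean] at hvar
  have e : ∀ z : Fin m → E, (1 / m * ∑ k, F (z k) - ∫ x, F x ∂π) ^ 2 =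
      (1 / m ^ 2) * (Y z - m * ∫ x, F x ∂π) ^ 2 := fun z => by
    rw [hYapp]
    field_simp
  simp only [e]
  rw [integral_const_mul, hvar]
  calc _ = ProbabilityTheory.variance F π / m := by field_simp
    _ ≤ _ := by gcongr

/-- Each of the two terms of the defect has mean at most `x`: averaging `m` samples divides the
variance by `m`, which the prefactor `m / A.card` undoes. The bound `M` is used for integrability
and does not enter the estimate. -/
lemma lintegral_blockDefect_le {A : Finset ℕ} (hA : A.Nonempty) {F : ℕ → E → ℝ} {N : E → ℝ}
    (hF : ∀ t, Measurable (F t)) (hN : Measurable N) (hN0 : ∀ x, 0 ≤ N x) {M : ℝ}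
    (hFM : ∀ t x, |F t x| ≤ M) (hNM : ∀ x, N x ≤ M) {x : ℝ}
    (hFx : ∀ t ∈ A, ∫ y, F t y ^ 2 ∂π ≤ x) (hNx : ∫ y, N y ∂π ≤ x) {m : ℕ} (hm : 0 < m) :
    ∫⁻ z : Fin m → E, ENNReal.ofReal (blockDefect π A F N z) ∂(Measure.pi fun _ => π) ≤
      ENNReal.ofReal (2 * x) := by
  have hm' : (0 : ℝ) < m := by exact_mod_cast hm
  have hA' : (0 : ℝ) < A.card := by exact_mod_cast hA.card_pos
  have hc : ∀ t, |∫ y, F t y ∂π| ≤ M := fun t => by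
    have := norm_integral_le_of_norm_le_const (μ := π) (f := F t)
      (Eventually.of_forall (hFM t))
    simpa using this
  have hM0 : 0 ≤ M := (abs_nonneg _).trans (hc 0)
  have hmean : ∀ t (z : Fin m → E), |1 / (m : ℝ) * ∑ k, F t (z k)| ≤ M := fun t z => by
    rw [abs_mul, abs_of_pos (by positivity : (0 : ℝ) < 1 / m), one_div, inv_mul_le_iff₀ hm']
    refine (Finset.abs_sum_le_sum_abs _ _).trans ?_
    refine (Finset.sum_le_sum fun k _ => hFM t (z k)).trans ?_
    simp
  have hmF := fun t (k : Fin m) =>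
    (hF t).comp (measurable_pi_apply (X := fun _ : Fin m => E) k)
  have hint1 : ∀ t, Integrable
      (fun z : Fin m → E => (1 / m * ∑ k, F t (z k) - ∫ y, F t y ∂π) ^ 2)
      (Measure.pi fun _ => π) := fun t => by
    refine Integrable.of_bound (Measurable.aestronglyMeasurable (by fun_prop)) ((2 * M) ^ 2)
      (Eventually.of_forall fun z => ?_)
    rw [Real.norm_eq_abs, abs_of_nonneg (sq_nonneg _), sq_le_sq, abs_of_nonneg (by positivity :
      0 ≤ 2 * M)]
    refine (abs_sub _ _).trans ?_
    linarith [hmean t z, hc t]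
  have hNint : Integrable N π := by
    refine Integrable.of_bound hN.aestronglyMeasurable M (Eventually.of_forall fun y => ?_)
    rw [Real.norm_eq_abs, abs_of_nonneg (hN0 y)]
    exact hNM y
  have hNk : ∀ k : Fin m, Integrable (fun z : Fin m → E => N (z k)) (Measure.pi fun _ => π) :=
    integrable_comp_eval π hNint
  have hI1 := (integrable_finsetSum A fun t _ => hint1 t).const_mul ((m : ℝ) / A.card)
  have hI2 := (integrable_finsetSum Finset.univ fun k _ => hNk k).const_mul (1 / (m : ℝ))
  have hI : Integrable (fun z : Fin m → E => blockDefect π A F N z) (Measure.pi fun _ => π) :=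
    hI1.add hI2
  rw [← ofReal_integral_eq_lintegral_ofReal hI
    (Eventually.of_forall fun z => blockDefect_nonneg π A F hN0 z)]
  refine ENNReal.ofReal_le_ofReal ?_
  unfold blockDefect
  rw [integral_add hI1 hI2, integral_const_mul, integral_const_mul,
    integral_finsetSum _ fun t _ => hint1 t, integral_finsetSum _ fun k _ => hNk k]
  have h1 : ∑ t ∈ A, ∫ z : Fin m → E, (1 / m * ∑ k, F t (z k) - ∫ y, F t y ∂π) ^ 2
      ∂(Measure.pi fun _ => π) ≤ A.card * (x / m) := by
    refine (Finset.sum_le_sum fun t ht => (integral_sq_mean_sub_le π hm (hF t) (hFM t)).trans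
      (div_le_div_of_nonneg_right (hFx t ht) hm'.le)).trans ?_
    simp
  have h2 : (1 : ℝ) / m * ∑ k : Fin m, ∫ z : Fin m → E, N (z k) ∂(Measure.pi fun _ => π) ≤ x := by
    simp only [integral_comp_eval π hN]
    simpa [hm'.ne'] using hNx
  have h3 := mul_le_mul_of_nonneg_left h1 (by positivity : (0 : ℝ) ≤ m / A.card)
  have h4 : (m : ℝ) / A.card * (A.card * (x / m)) = x := by field_simp
  linarith

/-- A product of independent nonnegative block statistics of mean at most `1` each, shifted
by `1`, exceeds `4 ^ B` with probability at most `2⁻ᴮ`. -/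
lemma measure_prod_one_add_ge_le {Ω : Type*} [MeasurableSpace Ω] (ν : Measure Ω)
    [IsProbabilityMeasure ν] (B : ℕ) {u : Ω → ℝ} (hu : Measurable u) (hu0 : ∀ z, 0 ≤ u z)
    (hmean : ∫⁻ z, ENNReal.ofReal (u z) ∂ν ≤ 1) :
    Measure.pi (fun _ : Fin B => ν) {z | (4 : ℝ) ^ B ≤ ∏ b, (1 + u (z b))} ≤ (2⁻¹ : ℝ≥0∞) ^ B := by
  have hind : ProbabilityTheory.iIndepFun
      (fun (b : Fin B) (z : Fin B → Ω) => ENNReal.ofReal (1 + u (z b))) (Measure.pi fun _ => ν) :=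
    ProbabilityTheory.iIndepFun_pi (X := fun _ z => ENNReal.ofReal (1 + u z))
      fun _ => by fun_prop
  have hone : ∀ b : Fin B,
      ∫⁻ z : Fin B → Ω, ENNReal.ofReal (1 + u (z b)) ∂(Measure.pi fun _ => ν) ≤ 2 := fun b => by
    have h := (measurePreserving_eval (fun _ : Fin B => ν) b).lintegral_comp
      (f := fun z => ENNReal.ofReal (1 + u z)) (by fun_prop)
    refine h.le.trans ?_
    have e : ∀ z, ENNReal.ofReal (1 + u z) = 1 + ENNReal.ofReal (u z) := fun z => by
      rw [ENNReal.ofReal_add zero_le_one (hu0 z), ENNReal.ofReal_one]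
    simp only [e]
    rw [lintegral_add_left measurable_const, lintegral_const, measure_univ, mul_one]
    calc (1 : ℝ≥0∞) + _ ≤ 1 + 1 := by gcongr
      _ = 2 := one_add_one_eq_two
  have hprod := ProbabilityTheory.lintegral_prod_eq_prod_lintegral_of_indepFun Finset.univ _ hind
    (fun b => by fun_prop)
  have hle : ∫⁻ z : Fin B → Ω, ∏ b, ENNReal.ofReal (1 + u (z b)) ∂(Measure.pi fun _ => ν) ≤
      2 ^ B := by
    rw [hprod]
    refine (Finset.prod_le_prod' fun b _ => hone b).trans ?_
    simp
  have hmk := meas_ge_le_lintegral_div (μ := Measure.pi fun _ : Fin B => ν)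
    (f := fun z => ∏ b, ENNReal.ofReal (1 + u (z b)))
    -- Markov at level `4 ^ B` against a mean of at most `2 ^ B`.
    (Measurable.aemeasurable (by fun_prop)) (ε := 4 ^ B)
    (by positivity) (by finiteness)
  have hset : {z : Fin B → Ω | (4 : ℝ) ^ B ≤ ∏ b, (1 + u (z b))} ⊆
      {z | (4 : ℝ≥0∞) ^ B ≤ ∏ b, ENNReal.ofReal (1 + u (z b))} := fun z hz => by
    simp only [Set.mem_ofPred_eq] at hz ⊢
    rw [← ENNReal.ofReal_prod_of_nonneg fun b _ => by linarith [hu0 (z b)]]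
    refine le_trans (le_of_eq ?_) (ENNReal.ofReal_le_ofReal hz)
    rw [ENNReal.ofReal_pow (by norm_num)]
    norm_num
  refine (measure_mono hset).trans (hmk.trans ?_)
  refine (ENNReal.div_le_div_right hle _).trans (le_of_eq ?_)
  have h4 : (4 : ℝ≥0∞) = 2 * 2 := by norm_num
  rw [h4, mul_pow, ENNReal.div_eq_inv_mul, ENNReal.mul_inv (by simp) (by simp), mul_assoc,
    ENNReal.inv_mul_cancel (by simp) (by simp), mul_one, ENNReal.inv_pow]

/-- With probability at least `1 - 2⁻ᴮ`, a combination of i.i.d. samples with small coefficients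
approximates finitely many means in mean square. -/
theorem measure_not_exists_coefficients_le {ι : Type*} [Fintype ι] {A : Finset ℕ}
    (hA : A.Nonempty) {F : ℕ → E → ℝ} {N : E → ℝ} (hF : ∀ t, Measurable (F t))
    (hN : Measurable N) (hN0 : ∀ x, 0 ≤ N x) {M : ℝ} (hFM : ∀ t x, |F t x| ≤ M)
    (hNM : ∀ x, N x ≤ M) {x : ℝ} (hx : 0 < x) (hFx : ∀ t ∈ A, ∫ y, F t y ^ 2 ∂π ≤ x)
    (hNx : ∫ y, N y ∂π ≤ x) {B m : ℕ} (hB : 0 < B) (hm : 0 < m) (hBm : B * m ≤ Fintype.card ι) :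
    Measure.pi (fun _ : ι => π) {ζ | ¬ ∃ c : ι → ℝ,
      ∑ t ∈ A, (∑ i, c i * F t (ζ i) - ∫ y, F t y ∂π) ^ 2 ≤ A.card * (8 * x / m) ∧
      ∑ i, c i ^ 2 * N (ζ i) ≤ 8 * x / (B * m)} ≤ (2⁻¹ : ℝ≥0∞) ^ B := by
  obtain ⟨e⟩ : Nonempty (Fin B × Fin m ↪ ι) :=
    Function.Embedding.nonempty_of_card_le (by simpa using hBm)
  have hmp := measurePreserving_blocks π (B := B) (m := m) e.injective
  have hmeas := measurable_blockDefect π A hF hN (m := m)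
  have hmean : ∫⁻ z : Fin m → E, ENNReal.ofReal (blockDefect π A F N z / (2 * x))
      ∂(Measure.pi fun _ => π) ≤ 1 := by
    have h := lintegral_blockDefect_le π hA hF hN hN0 hFM hNM hFx hNx hm
    have e : ∀ z : Fin m → E, ENNReal.ofReal (blockDefect π A F N z / (2 * x)) =
        ENNReal.ofReal (blockDefect π A F N z) / ENNReal.ofReal (2 * x) := fun z =>
      ENNReal.ofReal_div_of_pos (by positivity)
    rw [lintegral_congr e]
    simp only [ENNReal.div_eq_inv_mul]
    rw [lintegral_const_mul _ (by fun_prop), ← ENNReal.div_eq_inv_mul]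
    exact ENNReal.div_le_of_le_mul (by simpa using h)
  have hbound := measure_prod_one_add_ge_le (Measure.pi fun _ : Fin m => π) B
    (u := fun z => blockDefect π A F N z / (2 * x)) (by fun_prop)
    (fun z => div_nonneg (blockDefect_nonneg π A F hN0 z) (by positivity)) hmean
  rw [← hmp.measure_preimage (MeasurableSet.nullMeasurableSet
    (measurableSet_le (by fun_prop) (by fun_prop)))] at hbound
  refine (measure_mono fun ζ hζ => ?_).trans hbound
  by_contra hcon
  simp only [Set.mem_preimage, Set.mem_ofPred_eq, not_le] at hcon
  exact hζ (exists_coefficients π hA hN0 hx hB hm e.injective ζ hcon.le)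

end BlockSampling

/-! ### Temporal differences as means of sinusoids, and sampled comparators -/

/-- The temporal difference along a trajectory of the sinusoid with frequency `ζ` and amplitudes
`p ζ`, `q ζ`. -/
def tdSinusoid {d : ℕ} (γ : ℝ) (p q : State d → ℝ) (s : ℕ → State d) (t : ℕ) (ζ : State d) : ℝ :=
  p ζ * (Real.sin (inner ℝ ζ (s t)) - γ * Real.sin (inner ℝ ζ (s (t + 1)))) +
    q ζ * (Real.cos (inner ℝ ζ (s t)) - γ * Real.cos (inner ℝ ζ (s (t + 1))))

/-- Cauchy–Schwarz in the plane: a difference of a unit vector and `γ` times another has length at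
most `1 + γ`. -/
lemma sq_tdSinusoid_le {d : ℕ} {γ : ℝ} (hγ : 0 ≤ γ) (p q : State d → ℝ) (s : ℕ → State d) (t : ℕ)
    (ζ : State d) : tdSinusoid γ p q s t ζ ^ 2 ≤ (1 + γ) ^ 2 * (p ζ ^ 2 + q ζ ^ 2) := by
  simp only [tdSinusoid]
  generalize inner ℝ ζ (s t) = x
  generalize inner ℝ ζ (s (t + 1)) = y
  have h1 : (Real.sin x - γ * Real.sin y) ^ 2 + (Real.cos x - γ * Real.cos y) ^ 2 ≤
      (1 + γ) ^ 2 := by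
    have hc := Real.neg_one_le_cos (x - y)
    rw [Real.cos_sub] at hc
    nlinarith [Real.sin_sq_add_cos_sq x, Real.sin_sq_add_cos_sq y]
  have h2 : (p ζ * (Real.sin x - γ * Real.sin y) + q ζ * (Real.cos x - γ * Real.cos y)) ^ 2 ≤
      ((Real.sin x - γ * Real.sin y) ^ 2 + (Real.cos x - γ * Real.cos y) ^ 2) *
        (p ζ ^ 2 + q ζ ^ 2) := by
    nlinarith [sq_nonneg (p ζ * (Real.cos x - γ * Real.cos y) -
      q ζ * (Real.sin x - γ * Real.sin y))]
  exact h2.trans (mul_le_mul_of_nonneg_right h1 (by positivity))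

lemma continuous_tdSinusoid {d : ℕ} (γ : ℝ) {p q : State d → ℝ} (hp : Continuous p)
    (hq : Continuous q) (s : ℕ → State d) (t : ℕ) : Continuous (tdSinusoid γ p q s t) := by
  unfold tdSinusoid
  fun_prop

/-- The parameter vector with amplitudes `p`, `q` and coefficients `c` on the samples. -/
def sampledParameter {d D : ℕ} (p q : State d → ℝ) (c : Fin D → ℝ) (ζ : Fin D → State d) :
    FeatureIndex D → ℝ :=
  fun j => √(D : ℝ) * if j.2 = 0 then c j.1 * p (ζ j.1) else c j.1 * q (ζ j.1)

lemma tdFeature_dotProduct_sampledParameter {d D : ℕ} (γ : ℝ) (p q : State d → ℝ)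
    (c : Fin D → ℝ) (ζ : Fin D → State d) (s : ℕ → State d) (t : ℕ) :
    tdFeature γ ζ s t ⬝ᵥ sampledParameter p q c ζ = ∑ i, c i * tdSinusoid γ p q s t (ζ i) := by
  unfold tdFeature sampledParameter
  rw [sub_dotProduct, smul_dotProduct,
    randomFeature_dotProduct ζ (s t) (fun i => c i * p (ζ i)) (fun i => c i * q (ζ i)),
    randomFeature_dotProduct ζ (s (t + 1)) (fun i => c i * p (ζ i)) (fun i => c i * q (ζ i)),
    smul_eq_mul, Finset.mul_sum, ← Finset.sum_sub_distrib]
  refine Finset.sum_congr rfl fun i _ => ?_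
  simp only [tdSinusoid]
  ring

lemma sampledParameter_dotProduct_self {d D : ℕ} (p q : State d → ℝ) (c : Fin D → ℝ)
    (ζ : Fin D → State d) :
    sampledParameter p q c ζ ⬝ᵥ sampledParameter p q c ζ =
      D * ∑ i, c i ^ 2 * (p (ζ i) ^ 2 + q (ζ i) ^ 2) := by
  simp only [dotProduct, sampledParameter, Fintype.sum_prod_type, Fin.sum_univ_two, if_true,
    Fin.isValue, one_ne_zero, if_false]
  rw [Finset.mul_sum]
  refine Finset.sum_congr rfl fun i _ => ?_
  have h : √(D : ℝ) ^ 2 = D := Real.sq_sqrt (by positivity)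
  linear_combination (c i ^ 2 * (p (ζ i) ^ 2 + q (ζ i) ^ 2)) * h

/-- The temporal differences of `v` along the first `T` steps of a trajectory are means of
random sinusoids. -/
lemma exists_tdSinusoid_representation {d : ℕ} {S : Set (State d)}
    {H : Type*} [NormedAddCommGroup H] [InnerProductSpace ℝ H] [CompleteSpace H] [RKHS ℝ H S ℝ]
    {κbar : State d → State d → ℝ} {π : Measure (State d)} [IsProbabilityMeasure π] {γ σθ : ℝ}
    (hγ : 0 ≤ γ) (hσθ : 0 < σθ) (hπ : IsSpectralLaw κbar π)
    (hH : ∀ x y : S, RKHS.kernel H x y 1 = σθ ^ 2 * κbar x y) (v : H) (s : ℕ → S) (T : ℕ) :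
    ∃ p q : State d → ℝ, Continuous p ∧ Continuous q ∧
      (∃ M, (∀ t ζ, |tdSinusoid γ p q (fun t => (s t : State d)) t ζ| ≤ M) ∧
        ∀ ζ, p ζ ^ 2 + q ζ ^ 2 ≤ M) ∧
      (∫ ζ, (p ζ ^ 2 + q ζ ^ 2) ∂π ≤ (σθ * ‖v‖) ^ 2) ∧
      (∀ t, ∫ ζ, tdSinusoid γ p q (fun t => (s t : State d)) t ζ ^ 2 ∂π ≤
        ((1 + γ) * (σθ * ‖v‖)) ^ 2) ∧
      ∀ t ∈ Finset.Icc 1 T, ∫ ζ, tdSinusoid γ p q (fun t => (s t : State d)) t ζ ∂π =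
        v (s t) - γ * v (s (t + 1)) := by
  classical
  -- Slot `T` involves `s (T + 1)`, hence the range up to `T + 2`.
  obtain ⟨p, q, hp, hq, ⟨M, hM⟩, hN, hv⟩ := exists_spectral_representation hσθ hπ hH v
    ((Finset.range (T + 2)).image s)
  have hsq : ∀ ζ, p ζ ^ 2 + q ζ ^ 2 ≤ 2 * M ^ 2 := fun ζ => by
    have h1 := sq_le_sq.2 ((hM ζ).1.trans (le_abs_self _))
    have h2 := sq_le_sq.2 ((hM ζ).2.trans (le_abs_self _))
    linarith
  have hM0 : 0 ≤ M := (abs_nonneg _).trans (hM 0).1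
  have htd : ∀ t ζ, |tdSinusoid γ p q (fun t => (s t : State d)) t ζ| ≤ (1 + γ) * (2 * M) :=
    fun t ζ => by
      refine abs_le_of_sq_le_sq ?_ (by positivity)
      refine (sq_tdSinusoid_le hγ p q _ t ζ).trans ?_
      refine (mul_le_mul_of_nonneg_left (hsq ζ) (by positivity)).trans ?_
      nlinarith [sq_nonneg ((1 + γ) * M)]
  have hNint : Integrable (fun ζ => p ζ ^ 2 + q ζ ^ 2) π := by
    refine Integrable.of_bound (by fun_prop) (2 * M ^ 2) (Eventually.of_forall fun ζ => ?_)
    rw [Real.norm_eq_abs, abs_of_nonneg (by positivity)]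
    exact hsq ζ
  refine ⟨p, q, hp, hq, ⟨max ((1 + γ) * (2 * M)) (2 * M ^ 2),
    fun t ζ => (htd t ζ).trans (le_max_left _ _), fun ζ => (hsq ζ).trans (le_max_right _ _)⟩,
    hN, fun t => ?_, fun t ht => ?_⟩
  · calc _ ≤ ∫ ζ, (1 + γ) ^ 2 * (p ζ ^ 2 + q ζ ^ 2) ∂π := by
          refine integral_mono ?_ (hNint.const_mul _) fun ζ => sq_tdSinusoid_le hγ p q _ t ζ
          refine Integrable.of_bound
            ((continuous_tdSinusoid γ hp hq _ t).pow 2).aestronglyMeasurable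
            (((1 + γ) * (2 * M)) ^ 2) (Eventually.of_forall fun ζ => ?_)
          rw [Real.norm_eq_abs, abs_of_nonneg (sq_nonneg _)]
          exact sq_le_sq.2 ((htd t ζ).trans (le_abs_self _))
      _ ≤ (1 + γ) ^ 2 * (σθ * ‖v‖) ^ 2 := by
          rw [integral_const_mul]
          gcongr
      _ = _ := by ring
  · simp only [Finset.mem_Icc] at ht
    have hint : ∀ x : State d, Integrable
        (fun ζ : State d => p ζ * Real.sin (inner ℝ ζ x) + q ζ * Real.cos (inner ℝ ζ x)) π :=
      fun x => by
        refine Integrable.of_bound (by fun_prop) (M + M) (Eventually.of_forall fun ζ => ?_)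
        refine (norm_add_le _ _).trans (add_le_add ?_ ?_)
        · rw [norm_mul]
          exact (mul_le_of_le_one_right (norm_nonneg _) (Real.abs_sin_le_one _)).trans (hM ζ).1
        · rw [norm_mul]
          exact (mul_le_of_le_one_right (norm_nonneg _) (Real.abs_cos_le_one _)).trans (hM ζ).2
    rw [hv (s t) (Finset.mem_image_of_mem s (by simp; omega)),
      hv (s (t + 1)) (Finset.mem_image_of_mem s (by simp; omega)), ← integral_const_mul,
      ← integral_sub (hint _) ((hint _).const_mul γ)]
    refine integral_congr_ae (Eventually.of_forall fun ζ => ?_)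
    simp only [tdSinusoid]
    ring

/-- Some parameter vector of squared norm at most `N` reproduces the temporal differences of `v`
along the first `T` steps up to root mean square error `ρ`. -/
def HasApproximation {d D : ℕ} {S : Set (State d)} (γ ρ N : ℝ) (v : S → ℝ) (s : ℕ → S) (T : ℕ)
    (ζ : Fin D → State d) : Prop :=
  ∃ θ : FeatureIndex D → ℝ, θ ⬝ᵥ θ ≤ N ∧
    ∑ t ∈ Finset.Icc 1 T, (tdFeature γ ζ (fun t => (s t : State d)) t ⬝ᵥ θ -
      (v (s t) - γ * v (s (t + 1)))) ^ 2 ≤ T * ρ ^ 2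

instance {d D : ℕ} (π : Measure (State d)) [IsProbabilityMeasure π] :
    IsProbabilityMeasure (featureLaw D π) := by
  unfold featureLaw
  infer_instance

/-- Keeping `ρ`, `N` and `δ` free lets the same argument serve exact features, the zero comparator
and block sampling; `C` only has to dominate the resulting error and norm. -/
lemma measure_regret_ge_of_approximation {d D : ℕ} {S : Set (State d)} (hD : 0 < D)
    {π : Measure (State d)} [IsProbabilityMeasure π] {γ σθ σn Be ρ N C ε : ℝ} {δ : ℝ≥0∞}
    (hγ : 0 ≤ γ) (hσθ : 0 < σθ) (hσn : 0 < σn) (hρ : 0 ≤ ρ) (hε : 0 < ε)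
    {v : S → ℝ} {s : ℕ → S} {r : ℕ → ℝ} {T : ℕ}
    (hBe : BellmanErrorBounded D π γ σθ σn v s r T Be)
    (hρC : 3 * ρ ≤ 2 * (1 + γ) * ε * C) (hNC : 2 * σn ^ 2 * N ≤ C ^ 2)
    (hbad : featureLaw D π {ζ | ¬ HasApproximation γ ρ N v s T ζ} ≤ δ) :
    1 - δ ≤ featureLaw D π {ζ | bellmanRegret γ σθ σn v ζ s r T ≤
      2 * (1 + γ) * ε * Be * C * T + (1 + ε) * C ^ 2 / (2 * σθ ^ 2) +
        2 * D * Be ^ 2 * Real.log ((1 + γ) ^ 2 * σθ ^ 2 / σn ^ 2 * T + 1)} := by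
  set G := {ζ : Fin D → State d | bellmanRegret γ σθ σn v ζ s r T ≤
      2 * (1 + γ) * ε * Be * C * T + (1 + ε) * C ^ 2 / (2 * σθ ^ 2) +
        2 * D * Be ^ 2 * Real.log ((1 + γ) ^ 2 * σθ ^ 2 / σn ^ 2 * T + 1)} with hG
  have hlin : 3 * Be * ρ * T ≤ 2 * (1 + γ) * ε * Be * C * T := by
    rcases Nat.eq_zero_or_pos T with rfl | hT
    · simp
    have hBe0 : 0 ≤ Be := (abs_nonneg _).trans (hBe.2 1 (by simp; omega))
    have h0 : 0 ≤ Be * T := by positivity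
    nlinarith [mul_le_mul_of_nonneg_right hρC h0]
  have hpen : σn ^ 2 / σθ ^ 2 * N ≤ (1 + ε) * C ^ 2 / (2 * σθ ^ 2) := by
    have h1 : C ^ 2 ≤ (1 + ε) * C ^ 2 := le_mul_of_one_le_left (sq_nonneg _) (by linarith)
    calc σn ^ 2 / σθ ^ 2 * N = 2 * σn ^ 2 * N / (2 * σθ ^ 2) := by field_simp
      _ ≤ _ := div_le_div_of_nonneg_right (hNC.trans h1) (by positivity)
  have hcompl : featureLaw D π Gᶜ ≤ δ := by
    -- The online residuals are bounded only almost surely, so the inclusion of events holds modulo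
    -- a null set.
    refine (measure_mono_ae ?_).trans hbad
    filter_upwards [hBe.1] with ζ hζ hnot
    rintro ⟨θ, hθ, happ⟩
    refine hnot ?_
    have := bellmanRegret_le_of_approx hD hγ hσθ hσn hρ v ζ s r T hζ hBe.2 θ hθ happ
    simp only [hG, Set.mem_ofPred_eq]
    linarith
  -- Subadditivity on the event and its complement avoids any measurability of the regret event.
  rw [tsub_le_iff_right]
  calc (1 : ℝ≥0∞) = featureLaw D π (G ∪ Gᶜ) := by rw [Set.union_compl_self, measure_univ]
    _ ≤ featureLaw D π G + featureLaw D π Gᶜ := measure_union_le _ _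
    _ ≤ _ := by gcongr

/-! ### Probability that a good comparator exists -/

section Approximation

variable {d : ℕ} {S : Set (State d)}
  {H : Type*} [NormedAddCommGroup H] [InnerProductSpace ℝ H] [CompleteSpace H] [RKHS ℝ H S ℝ]
  {κbar : State d → State d → ℝ} {π : Measure (State d)} [IsProbabilityMeasure π] {γ σθ : ℝ}

/-- The square of a mean is at most the mean of the square, applied to the spectral representation.
-/
lemma sq_temporal_difference_le (hγ : 0 ≤ γ) (hσθ : 0 < σθ) (hπ : IsSpectralLaw κbar π)
    (hH : ∀ x y : S, RKHS.kernel H x y 1 = σθ ^ 2 * κbar x y) (v : H) (s : ℕ → S) {T t : ℕ}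
    (ht : t ∈ Finset.Icc 1 T) :
    (v (s t) - γ * v (s (t + 1))) ^ 2 ≤ ((1 + γ) * (σθ * ‖v‖)) ^ 2 := by
  obtain ⟨p, q, hp, hq, ⟨M, hM, -⟩, -, hF, hv⟩ :=
    exists_tdSinusoid_representation hγ hσθ hπ hH v s T
  rw [← hv t ht]
  refine le_trans ?_ (hF t)
  have hmem : MemLp (tdSinusoid γ p q (fun t => (s t : State d)) t) 2 π :=
    MemLp.of_bound (continuous_tdSinusoid γ hp hq _ t).aestronglyMeasurable M
      (Eventually.of_forall (hM t))
  have h := ProbabilityTheory.variance_nonneg (tdSinusoid γ p q (fun t => (s t : State d)) t) π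
  rw [ProbabilityTheory.variance_eq_sub hmem] at h
  simpa using h

lemma hasApproximation_zero {D : ℕ} (hγ : 0 ≤ γ) (hσθ : 0 < σθ) (hπ : IsSpectralLaw κbar π)
    (hH : ∀ x y : S, RKHS.kernel H x y 1 = σθ ^ 2 * κbar x y) (v : H) (s : ℕ → S) (T : ℕ)
    (ζ : Fin D → State d) :
    HasApproximation γ ((1 + γ) * (σθ * ‖v‖)) 0 (fun x => v x) s T ζ := by
  refine ⟨0, by simp, ?_⟩
  calc _ ≤ ∑ t ∈ Finset.Icc 1 T, ((1 + γ) * (σθ * ‖v‖)) ^ 2 := by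
        refine Finset.sum_le_sum fun t ht => ?_
        rw [dotProduct_zero, zero_sub, neg_sq]
        exact sq_temporal_difference_le hγ hσθ hπ hH v s ht
    _ = _ := by simp

/-- When the spectral law is concentrated at the origin, the features are exact. -/
lemma ae_hasApproximation_of_secondMoment_eq_zero {D : ℕ} (hD : 0 < D) (hγ : 0 ≤ γ)
    (hσθ : 0 < σθ) (hπ : IsSpectralLaw κbar π)
    (hH : ∀ x y : S, RKHS.kernel H x y 1 = σθ ^ 2 * κbar x y) (hπ0 : secondMoment π = 0) (v : H)
    (s : ℕ → S) (T : ℕ) :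
    ∀ᵐ ζ ∂(featureLaw D π), HasApproximation γ 0 ((σθ * ‖v‖) ^ 2) (fun x => v x) s T ζ := by
  have hD' : (0 : ℝ) < D := by exact_mod_cast hD
  have hzero : ∀ᵐ x ∂π, x = 0 := by
    rw [secondMoment, lintegral_eq_zero_iff (by fun_prop)] at hπ0
    filter_upwards [hπ0] with x hx
    simpa using hx
  have hall : ∀ᵐ ζ ∂(featureLaw D π), ∀ i, ζ i = 0 := by
    rw [ae_all_iff]
    intro i
    exact (Measure.quasiMeasurePreserving_eval (fun _ : Fin D => π) i).ae hzero
  obtain ⟨p, q, -, -, -, hN, -, hv⟩ := exists_tdSinusoid_representation hγ hσθ hπ hH v s T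
  have hconst : ∀ f : State d → ℝ, ∫ x, f x ∂π = f 0 := fun f => by
    rw [integral_congr_ae (g := fun _ => f 0) (by
      filter_upwards [hzero] with x hx
      rw [hx])]
    simp
  rw [hconst] at hN
  filter_upwards [hall] with ζ hζ
  refine ⟨sampledParameter p q (fun _ => 1 / D) ζ, ?_, ?_⟩
  · rw [sampledParameter_dotProduct_self]
    refine le_trans (le_of_eq ?_) hN
    simp only [hζ, Finset.sum_const, Finset.card_univ, Fintype.card_fin, nsmul_eq_mul]
    field_simp
  · refine le_of_eq ?_
    rw [Finset.sum_eq_zero]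
    · simp
    · intro t ht
      rw [← hv t ht, hconst, tdFeature_dotProduct_sampledParameter]
      simp only [hζ, Finset.sum_const, Finset.card_univ, Fintype.card_fin, nsmul_eq_mul]
      field_simp
      simp

/-- `B` disjoint blocks of `m` features give mean square accuracy of order `1 / m` outside an
event of probability at most `2⁻ᴮ`. -/
lemma measure_not_hasApproximation_le {D B m : ℕ} (hγ : 0 ≤ γ) (hγ1 : γ < 1) (hσθ : 0 < σθ)
    (hπ : IsSpectralLaw κbar π)
    (hH : ∀ x y : S, RKHS.kernel H x y 1 = σθ ^ 2 * κbar x y) (v : H) (s : ℕ → S) (T : ℕ)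
    {G ρ : ℝ} (hG : 0 < G) (hvG : σθ * ‖v‖ ≤ G) (hB : 0 < B) (hm : 0 < m) (hBm : B * m ≤ D)
    (hDBm : D ≤ 2 * (B * m)) (hρ : 32 * G ^ 2 / m ≤ ρ ^ 2) :
    featureLaw D π {ζ | ¬ HasApproximation γ ρ (64 * G ^ 2) (fun x => v x) s T ζ} ≤
      (2⁻¹ : ℝ≥0∞) ^ B := by
  rcases Nat.eq_zero_or_pos T with rfl | hT
  · have : {ζ : Fin D → State d | ¬ HasApproximation γ ρ (64 * G ^ 2) (fun x => v x) s 0 ζ} = ∅ := by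
      ext ζ
      simp only [Set.mem_ofPred_eq, Set.mem_empty_iff_false, iff_false, not_not]
      refine ⟨0, ?_, by simp⟩
      rw [dotProduct_zero]
      positivity
    rw [this, measure_empty]
    exact zero_le
  obtain ⟨p, q, hp, hq, ⟨M, hFM, hNM⟩, hN, hF, hv⟩ :=
    exists_tdSinusoid_representation hγ hσθ hπ hH v s T
  have hm' : (0 : ℝ) < m := by exact_mod_cast hm
  have hB' : (0 : ℝ) < B := by exact_mod_cast hB
  have hv0 : 0 ≤ σθ * ‖v‖ := by positivity
  have hsq : (σθ * ‖v‖) ^ 2 ≤ G ^ 2 := by gcongr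
  -- The level `4 G²` dominates both second moments since `1 + γ ≤ 2`. It gives error `32 G² / m`,
  -- and `D ≤ 2 B m` turns the coefficient bound into squared norm `64 G²`.
  have h := BlockSampling.measure_not_exists_coefficients_le π (ι := Fin D)
    (A := Finset.Icc 1 T) (Finset.nonempty_Icc.2 hT)
    (F := fun t => tdSinusoid γ p q (fun t => (s t : State d)) t)
    (N := fun x => p x ^ 2 + q x ^ 2)
    (fun t => (continuous_tdSinusoid γ hp hq _ t).measurable) (by fun_prop)
    (fun x => by positivity) hFM hNM (x := 4 * G ^ 2) (by positivity)
    (fun t _ => (hF t).trans (by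
      rw [mul_pow]
      have : (1 + γ) ^ 2 ≤ 4 := by nlinarith
      gcongr))
    (hN.trans (by nlinarith)) hB hm (by simpa using hBm)
  refine (measure_mono fun ζ hζ => ?_).trans h
  simp only [Set.mem_ofPred_eq] at hζ ⊢
  refine fun hex => hζ ?_
  obtain ⟨c, hc1, hc2⟩ := hex
  refine ⟨sampledParameter p q c ζ, ?_, ?_⟩
  · rw [sampledParameter_dotProduct_self]
    have hD2 : (D : ℝ) ≤ 2 * (B * m) := by exact_mod_cast hDBm
    calc (D : ℝ) * ∑ i, c i ^ 2 * (p (ζ i) ^ 2 + q (ζ i) ^ 2)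
        ≤ (2 * (B * m)) * (8 * (4 * G ^ 2) / (B * m)) := by
          refine mul_le_mul hD2 hc2 ?_ (by positivity)
          exact Finset.sum_nonneg fun i _ => by positivity
      _ = _ := by
        field_simp
        norm_num
  · calc _ = ∑ t ∈ Finset.Icc 1 T,
          (∑ i, c i * tdSinusoid γ p q (fun t => (s t : State d)) t (ζ i) -
            ∫ y, tdSinusoid γ p q (fun t => (s t : State d)) t y ∂π) ^ 2 := by
          refine Finset.sum_congr rfl fun t ht => ?_
          rw [hv t ht, tdFeature_dotProduct_sampledParameter]
      _ ≤ _ := hc1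
      _ ≤ _ := by
          rw [Nat.card_Icc, add_tsub_cancel_right]
          have e : 8 * (4 * G ^ 2) / m = 32 * G ^ 2 / m := by ring
          rw [e]
          gcongr

end Approximation

/-! ### Block sizes, constants and the two regret bounds -/

/-- A choice of block length and number of blocks for accuracy `ε`. -/
lemma exists_block_sizes {D d : ℕ} {ε : ℝ} (hε : 0 < ε) (hε1 : ε ≤ 1)
    (hDε : 4 * (d : ℝ) + 8 ≤ D * ε ^ 2) :
    ∃ B m : ℕ, 0 < B ∧ 0 < m ∧ B * m ≤ D ∧ D ≤ 2 * (B * m) ∧ 1 / ε ^ 2 ≤ (m : ℝ) ∧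
      (2⁻¹ : ℝ) ^ B ≤ Real.exp (-((D : ℝ) * ε ^ 2 / (4 * (d : ℝ) + 8))) := by
  have hε2 : 0 < ε ^ 2 := by positivity
  have hε21 : ε ^ 2 ≤ 1 := pow_le_one₀ hε.le hε1
  set m := ⌈1 / ε ^ 2⌉₊ with hmdef
  have hm : 0 < m := Nat.ceil_pos.2 (by positivity)
  have hm' : (0 : ℝ) < m := by exact_mod_cast hm
  have hmle : (m : ℝ) * ε ^ 2 ≤ 2 := by
    have h1 : (m : ℝ) < 1 / ε ^ 2 + 1 := Nat.ceil_lt_add_one (by positivity)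
    have h2 : 1 / ε ^ 2 * ε ^ 2 = 1 := by field_simp
    nlinarith
  have hd : (0 : ℝ) ≤ d := by positivity
  have hlt : (D : ℝ) < (D / m + 1 : ℕ) * m := by
    exact_mod_cast Nat.lt_mul_of_div_lt (Nat.lt_succ_self _) hm
  set B := D / m with hBdef
  push_cast at hlt
  -- From `D < (B + 1) m` and `m ε² ≤ 2` one gets `B ≥ D ε² / 2 - 1`; the hypothesis `D ε² ≥ 8`
  -- absorbs the 1.
  have hBlow : (D : ℝ) * ε ^ 2 / 4 ≤ B := by
    have h1 : (D : ℝ) * ε ^ 2 ≤ (B + 1) * (m * ε ^ 2) := by nlinarith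
    have h2 : ((B : ℝ) + 1) * (m * ε ^ 2) ≤ (B + 1) * 2 := by gcongr
    linarith
  have hB1 : (1 : ℝ) ≤ B := by linarith
  have hB : 0 < B := by exact_mod_cast (by linarith : (0 : ℝ) < B)
  refine ⟨B, m, hB, hm, Nat.div_mul_le_self D m, ?_, Nat.le_ceil _, ?_⟩
  · have : (D : ℝ) ≤ 2 * (B * m) := by nlinarith
    exact_mod_cast this
  · have h1 : (2⁻¹ : ℝ) ^ B = Real.exp (-(B * Real.log 2)) := by
      rw [← mul_neg, Real.exp_nat_mul, Real.exp_neg, Real.exp_log (by norm_num)]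
    rw [h1, Real.exp_le_exp, neg_le_neg_iff, div_le_iff₀ (by positivity)]
    have h2 : (1 : ℝ) / 2 ≤ Real.log 2 := by linarith [Real.log_two_gt_d9]
    have h3 : (B : ℝ) * (1 / 2) ≤ B * Real.log 2 := by gcongr
    have h4 : (D : ℝ) * ε ^ 2 / 8 ≤ B * Real.log 2 := by linarith
    have h5 : 0 ≤ (B : ℝ) * Real.log 2 := by positivity
    nlinarith

lemma failureBound_eq_ofReal {d : ℕ} (D : ℕ) {π : Measure (State d)} (hπ : secondMoment π ≠ ⊤)
    {ε : ℝ} (hε : 0 < ε) :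
    failureBound D π ε = ENNReal.ofReal (2 ^ 8 * (secondMoment π).toReal / ε ^ 2 *
      Real.exp (-((D : ℝ) * ε ^ 2 / (4 * (d : ℝ) + 8)))) := by
  rw [failureBound, ENNReal.ofReal_mul (by positivity), ENNReal.ofReal_div_of_pos (by positivity),
    ENNReal.ofReal_mul (by positivity), ENNReal.ofReal_toReal hπ, ENNReal.ofReal_pow (zero_le_two : (0 : ℝ) ≤ 2)]
  congr 3
  norm_num

lemma failureBound_eq_top {d : ℕ} (D : ℕ) {π : Measure (State d)} (hπ : secondMoment π = ⊤)
    (ε : ℝ) : failureBound D π ε = ⊤ := by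
  rw [failureBound, hπ, ENNReal.mul_top (by norm_num), ENNReal.top_div_of_ne_top (by simp),
    ENNReal.top_mul]
  simpa using Real.exp_pos _

theorem exists_regret_bound {d : ℕ} {S : Set (State d)}
    {H : Type*} [NormedAddCommGroup H] [InnerProductSpace ℝ H] [CompleteSpace H] [RKHS ℝ H S ℝ]
    {κbar : State d → State d → ℝ} {π : Measure (State d)} [IsProbabilityMeasure π]
    {γ σθ σn : ℝ} (hγ0 : 0 ≤ γ) (hγ1 : γ < 1) (hσθ : 0 < σθ) (hσn : 0 < σn)
    (hπ : IsSpectralLaw κbar π)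
    (hH : ∀ x y : S, RKHS.kernel H x y 1 = σθ ^ 2 * κbar x y) (v : H) :
    ∃ C : ℝ, 0 < C ∧
      ∀ (D : ℕ), 0 < D → ∀ (s : ℕ → S) (r : ℕ → ℝ) (T : ℕ) (Be : ℝ),
        BellmanErrorBounded D π γ σθ σn (fun x => v x) s r T Be →
        ∀ ε : ℝ, 0 < ε →
          1 - failureBound D π ε ≤ featureLaw D π
            {ζ | bellmanRegret γ σθ σn (fun x => v x) ζ s r T ≤
              2 * (1 + γ) * ε * Be * C * T + (1 + ε) * C ^ 2 / (2 * σθ ^ 2) +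
                2 * D * Be ^ 2 * Real.log ((1 + γ) ^ 2 * σθ ^ 2 / σn ^ 2 * T + 1)} := by
  -- The added 1 keeps `G` positive when `v = 0`.
  set G : ℝ := σθ * ‖v‖ + 1 with hGdef
  have hv0 : 0 ≤ σθ * ‖v‖ := by positivity
  have hG : 0 < G := by positivity
  have hvG : σθ * ‖v‖ ≤ G := by linarith
  by_cases htop : secondMoment π = ⊤
  · refine ⟨1, one_pos, fun D hD s r T Be hBe ε hε => ?_⟩
    rw [failureBound_eq_top D htop]
    simp
  by_cases hzero : secondMoment π = 0
  -- Here the failure bound is 0, so the comparator must work almost surely.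
  · refine ⟨2 * σn * G, by positivity, fun D hD s r T Be hBe ε hε => ?_⟩
    refine measure_regret_ge_of_approximation hD hγ0 hσθ hσn le_rfl hε hBe (N := (σθ * ‖v‖) ^ 2)
      (by rw [mul_zero]; positivity) ?_ ?_
    · have : (σθ * ‖v‖) ^ 2 ≤ G ^ 2 := by gcongr
      nlinarith [sq_nonneg (σn * G), mul_le_mul_of_nonneg_left this (sq_nonneg σn)]
    · have h := ae_hasApproximation_of_secondMoment_eq_zero hD hγ0 hσθ hπ hH hzero v s T
      rw [ae_iff] at h
      rw [h]
      exact zero_le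
  set w : ℝ := (secondMoment π).toReal with hw
  have hwpos : 0 < w := ENNReal.toReal_pos hzero htop
  -- Below `ε₀` the prefactor `2⁸ w / ε²` is at least 4, which exceeds `e`.
  set ε₀ : ℝ := min 1 (√(64 * w)) with hε₀
  have hε₀pos : 0 < ε₀ := lt_min one_pos (by positivity)
  -- The three terms cover, in order, the accuracy `6 G ε`, the squared norm `64 G²`, and the zero
  -- comparator when `ε ≥ ε₀`.
  set C : ℝ := 9 * G + 12 * σn * G + 2 * G / ε₀ with hC
  have hC1 : 9 * G ≤ C := by
    have : 0 ≤ 12 * σn * G + 2 * G / ε₀ := by positivity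
    linarith
  have hC2 : 12 * σn * G ≤ C := by
    have : 0 ≤ 9 * G + 2 * G / ε₀ := by positivity
    linarith
  have hC3 : 2 * G / ε₀ ≤ C := by
    have : 0 ≤ 9 * G + 12 * σn * G := by positivity
    linarith
  have hCpos : 0 < C := by linarith
  refine ⟨C, hCpos, fun D hD s r T Be hBe ε hε => ?_⟩
  rcases le_or_gt ε₀ ε with hle | hlt
  · refine measure_regret_ge_of_approximation hD hγ0 hσθ hσn (ρ := (1 + γ) * (σθ * ‖v‖)) (N := 0)
      (by positivity) hε hBe ?_ (by rw [mul_zero]; positivity) ?_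
    · have h1 : 2 * G ≤ ε * C := by
        calc 2 * G = ε₀ * (2 * G / ε₀) := by field_simp
          _ ≤ ε * C := by gcongr
      have h2 : (1 + γ) * (3 * (σθ * ‖v‖)) ≤ (1 + γ) * (2 * (ε * C)) := by
        exact mul_le_mul_of_nonneg_left (by linarith) (by linarith)
      linarith
    · have : {ζ : Fin D → State d |
          ¬ HasApproximation γ ((1 + γ) * (σθ * ‖v‖)) 0 (fun x => v x) s T ζ} = ∅ := by
        ext ζ
        simpa using hasApproximation_zero hγ0 hσθ hπ hH v s T ζ
      rw [this, measure_empty]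
      exact zero_le
  · rcases le_or_gt 1 (failureBound D π ε) with hfb | hfb
    · rw [tsub_eq_zero_of_le hfb]
      exact zero_le
    have hε1 : ε ≤ 1 := hlt.le.trans (min_le_left _ _)
    have hεw : ε ^ 2 ≤ 64 * w := by
      have := hlt.le.trans (min_le_right _ _)
      exact (Real.le_sqrt' hε).1 this
    rw [failureBound_eq_ofReal D htop hε] at hfb ⊢
    set y : ℝ := (D : ℝ) * ε ^ 2 / (4 * (d : ℝ) + 8) with hy
    have hfac : (4 : ℝ) ≤ 2 ^ 8 * w / ε ^ 2 := by
      rw [le_div_iff₀ (by positivity)]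
      linarith
    -- If `y < 1`, the failure bound would be at least `4 / e > 1`. So a nontrivial claim forces `D
    -- ε² ≥ 4 d + 8`, enough features to form blocks.
    have hy1 : 1 ≤ y := by
      by_contra hcon
      push Not at hcon
      have h1 : Real.exp (-1) ≤ Real.exp (-y) := Real.exp_le_exp.2 (by linarith)
      have h2 : (1 : ℝ) / 4 ≤ Real.exp (-1) := by
        rw [Real.exp_neg, one_div]
        exact inv_anti₀ (Real.exp_pos 1) (by linarith [Real.exp_one_lt_d9])
      rw [ENNReal.ofReal_lt_one] at hfb
      nlinarith [Real.exp_pos (-y)]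
    have hDε : 4 * (d : ℝ) + 8 ≤ D * ε ^ 2 := by
      rw [hy, le_div_iff₀ (by positivity)] at hy1
      linarith
    obtain ⟨B, m, hB, hm, hBm, hDBm, hmε, hpow⟩ := exists_block_sizes hε hε1 hDε
    have hm' : (0 : ℝ) < m := by exact_mod_cast hm
    refine measure_regret_ge_of_approximation hD hγ0 hσθ hσn (ρ := 6 * G * ε) (N := 64 * G ^ 2)
      (by positivity) hε hBe ?_ ?_ ?_
    · have h1 : 9 * G * ε ≤ C * ε := by gcongr
      have h2 : 0 ≤ γ * (ε * C) := by positivity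
      linarith
    · have h1 : (12 * σn * G) ^ 2 ≤ C ^ 2 := by gcongr
      nlinarith [sq_nonneg (σn * G)]
    · refine (measure_not_hasApproximation_le hγ0 hγ1 hσθ hπ hH v s T hG hvG hB hm hBm hDBm
        ?_).trans ?_
      · have h1 : 1 / (m : ℝ) ≤ ε ^ 2 := by
          rw [div_le_iff₀ (by positivity)] at hmε ⊢
          linarith
        calc 32 * G ^ 2 / m = 32 * G ^ 2 * (1 / m) := by ring
          _ ≤ 36 * G ^ 2 * ε ^ 2 := by gcongr; norm_num
          _ = _ := by ring
      · have e : (2⁻¹ : ℝ≥0∞) ^ B = ENNReal.ofReal ((2⁻¹ : ℝ) ^ B) := by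
          rw [ENNReal.ofReal_pow (by norm_num), ENNReal.ofReal_inv_of_pos (by norm_num)]
          norm_num
        rw [e]
        refine ENNReal.ofReal_le_ofReal (hpow.trans ?_)
        exact le_mul_of_one_le_left (Real.exp_pos _).le (by linarith)

/-- The regret bound is `O(D log T)` when `ε T = O(log T / T)`. -/
lemma exists_log_bound {γ σθ σn C : ℝ} (hγ : 0 ≤ γ) (hC : 0 < C) {ε : ℕ → ℝ} (hε : ∀ T, 0 < ε T)
    (hO : ε =O[atTop] fun T : ℕ => Real.log T / T) (Be : ℝ) :
    ∃ K : ℝ, ∀ (D : ℕ), 0 < D → ∀ T : ℕ, 2 ≤ T →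
      2 * (1 + γ) * ε T * Be * C * T + (1 + ε T) * C ^ 2 / (2 * σθ ^ 2) +
        2 * D * Be ^ 2 * Real.log ((1 + γ) ^ 2 * σθ ^ 2 / σn ^ 2 * T + 1) ≤
        K * D * Real.log T := by
  -- On `ℕ` the asymptotic bound holds, with a larger constant, wherever `log T / T ≠ 0`, in
  -- particular for all `T ≥ 2`. The terms constant in `T` are then absorbed using `log 2 ≤ log T`.
  obtain ⟨c, hc, hbound⟩ := bound_of_isBigO_nat_atTop hO
  set a : ℝ := (1 + γ) ^ 2 * σθ ^ 2 / σn ^ 2 with ha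
  have ha0 : 0 ≤ a := by positivity
  have hlog2 : 0 < Real.log 2 := Real.log_pos (by norm_num)
  have hla : 0 ≤ Real.log (a + 1) := Real.log_nonneg (by linarith)
  set k₁ : ℝ := 2 * (1 + γ) * c * |Be| * C with hk₁
  set k₂ : ℝ := (1 + c) * C ^ 2 / (2 * σθ ^ 2) / Real.log 2 with hk₂
  set k₃ : ℝ := 2 * Be ^ 2 * (Real.log (a + 1) / Real.log 2 + 1) with hk₃
  have hk₁0 : 0 ≤ k₁ := by positivity
  have hk₂0 : 0 ≤ k₂ := by positivity
  refine ⟨k₁ + k₂ + k₃, fun D hD T hT => ?_⟩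
  have hD1 : (1 : ℝ) ≤ D := by exact_mod_cast hD
  have hT2 : (2 : ℝ) ≤ T := by exact_mod_cast hT
  have hT0 : (0 : ℝ) < T := by linarith
  have hlog2T : Real.log 2 ≤ Real.log T := Real.log_le_log (by norm_num) hT2
  have hlogT : 0 < Real.log T := hlog2.trans_le hlog2T
  have hεT : ε T ≤ c * (Real.log T / T) := by
    have h := hbound (x := T) (by positivity)
    rwa [Real.norm_eq_abs, Real.norm_eq_abs, abs_of_pos (hε T), abs_of_pos (by positivity)] at h
  have hεc : ε T ≤ c := by
    refine hεT.trans (mul_le_of_le_one_right hc.le ?_)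
    rw [div_le_one hT0]
    linarith [Real.log_le_sub_one_of_pos hT0]
  have h1 : 2 * (1 + γ) * ε T * Be * C * T ≤ k₁ * Real.log T := by
    have hε0 := hε T
    have e1 : ε T * T ≤ c * Real.log T := by
      calc ε T * T ≤ c * (Real.log T / T) * T := by gcongr
        _ = _ := by field_simp
    calc 2 * (1 + γ) * ε T * Be * C * T = 2 * (1 + γ) * C * (ε T * T) * Be := by ring
      _ ≤ 2 * (1 + γ) * C * (ε T * T) * |Be| := by
          gcongr
          exact le_abs_self Be
      _ ≤ 2 * (1 + γ) * C * (c * Real.log T) * |Be| := by gcongr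
      _ = _ := by ring
  have h2 : (1 + ε T) * C ^ 2 / (2 * σθ ^ 2) ≤ k₂ * Real.log T := by
    calc (1 + ε T) * C ^ 2 / (2 * σθ ^ 2) ≤ (1 + c) * C ^ 2 / (2 * σθ ^ 2) := by gcongr
      _ = k₂ * Real.log 2 := by rw [hk₂]; field_simp
      _ ≤ _ := by gcongr
  have h3 : Real.log (a * T + 1) ≤ (Real.log (a + 1) / Real.log 2 + 1) * Real.log T := by
    calc Real.log (a * T + 1) ≤ Real.log ((a + 1) * T) :=
          Real.log_le_log (by positivity) (by linarith)
      _ = Real.log (a + 1) + Real.log T := Real.log_mul (by positivity) hT0.ne'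
      _ = Real.log (a + 1) / Real.log 2 * Real.log 2 + Real.log T := by field_simp
      _ ≤ Real.log (a + 1) / Real.log 2 * Real.log T + Real.log T := by gcongr
      _ = _ := by ring
  have h4 : 2 * D * Be ^ 2 * Real.log (a * T + 1) ≤ k₃ * D * Real.log T := by
    calc _ ≤ 2 * D * Be ^ 2 * ((Real.log (a + 1) / Real.log 2 + 1) * Real.log T) := by gcongr
      _ = _ := by rw [hk₃]; ring
  have h5 : (k₁ + k₂) * Real.log T ≤ (k₁ + k₂) * D * Real.log T := by
    have : 0 ≤ (k₁ + k₂) * Real.log T := by positivity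
    nlinarith
  linarith

end

theorem theorem1 {d : ℕ} {S : Set (State d)}
    {H : Type*} [NormedAddCommGroup H] [InnerProductSpace ℝ H] [CompleteSpace H] [RKHS ℝ H S ℝ]
    (κbar : State d → State d → ℝ) (π : Measure (State d)) [IsProbabilityMeasure π]
    (γ σθ σn : ℝ) (hγ0 : 0 ≤ γ) (hγ1 : γ < 1) (hσθ : 0 < σθ) (hσn : 0 < σn)
    (hκ : IsStandardizedShiftInvariant κbar) (hπ : IsSpectralLaw κbar π)
    -- `H` is the reproducing kernel Hilbert space on `S` of the kernel `κ = σθ² κbar`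
    (hH : ∀ x y : S, RKHS.kernel H x y 1 = σθ ^ 2 * κbar x y)
    (v : H) :
    (∃ C : ℝ, 0 < C ∧
      ∀ (D : ℕ), 0 < D → ∀ (s : ℕ → S) (r : ℕ → ℝ) (T : ℕ) (Be : ℝ),
        BellmanErrorBounded D π γ σθ σn (fun x => v x) s r T Be →
        ∀ ε : ℝ, 0 < ε →
          1 - failureBound D π ε ≤ featureLaw D π
            {ζ | bellmanRegret γ σθ σn (fun x => v x) ζ s r T ≤
              2 * (1 + γ) * ε * Be * C * T + (1 + ε) * C ^ 2 / (2 * σθ ^ 2) +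
                2 * D * Be ^ 2 * Real.log ((1 + γ) ^ 2 * σθ ^ 2 / σn ^ 2 * T + 1)}) ∧
    (∀ ε : ℕ → ℝ, (∀ T, 0 < ε T) →
      (ε =O[atTop] fun T : ℕ => Real.log T / T) →
      ∀ Be : ℝ, ∃ K : ℝ,
        ∀ (D : ℕ), 0 < D → ∀ (s : ℕ → S) (r : ℕ → ℝ) (T : ℕ), 2 ≤ T →
          BellmanErrorBounded D π γ σθ σn (fun x => v x) s r T Be →
          1 - failureBound D π (ε T) ≤ featureLaw D π
            {ζ | bellmanRegret γ σθ σn (fun x => v x) ζ s r T ≤ K * D * Real.log T}) := by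
  obtain ⟨C, hC, hbound⟩ := exists_regret_bound hγ0 hγ1 hσθ hσn hπ hH v
  refine ⟨⟨C, hC, hbound⟩, fun ε hε hO Be => ?_⟩
  obtain ⟨K, hK⟩ := exists_log_bound (σθ := σθ) (σn := σn) hγ0 hC hε hO Be
  refine ⟨K, fun D hD s r T hT hBe => (hbound D hD s r T Be hBe (ε T) (hε T)).trans ?_⟩
  exact measure_mono fun ζ hζ => le_trans hζ (hK D hD T hT)
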